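/- **Model.** Two users $A,B$, a relay $R$ and a destination $D$ communicate in three slots: $A$ transmits, $B$ transmits, $R$ transmits. The users' information bits are independent and uniform. All gains are independent circular zero-mean complex Gaussian and constant during a block: $|h_{A,D}|^2,|h_{B,D}|^2,|h_{R,D}|^2$ are exponential with rate $\lambda>0$, and $|h_{A,R}|^2,|h_{B,R}|^2$ are exponential with rate $\lambda_R>0$. All noises are independent circular complex Gaussian of power $N_0>0$. Symbols are BPSK. Let $\mathrm{snr}_0=P/N_0$. Uncoded transmission of blocks of $n$ bits uses symbol energy $P$. Convolutionally coded transmission uses a polynomial generator matrix $G\in\mathbb F_2[X]^{k_0\times n_0}$ with injective encoding map, $L$ input frames of $k_0$ bits per block and zero termination, energy $P$ per information bit (symbol energy $rP$ with rate $r=k_0/n_0$), and hard-decision Viterbi (minimum Hamming distance) decoding at relay and destination, with arbitrary tie-breaking. Let $d_{free}$ be the free distance (least weight of a nonzero code sequence) and $\mathrm{snr}_0^c=\mathrm{snr}_0\, r\, d_{free}/2$. The relay makes coherent decisions on each user's block, knows which blocks it has decoded correctly, and transmits the sum of the re-modulated correctly decoded blocks (nothing if there is none). The destination knows the gains and the relay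 state. A user $u$ whose block is not forwarded is detected from its direct transmission. If only the block of $u$ is forwarded, the direct and the relay signal are combined by maximum ratio combining (MRC). If both are forwarded, the user with the larger SNR $\big(|h_{u,D}|^2+\frac{|h_{v,D}h_{R,D}|^2}{|h_{v,D}|^2+|h_{R,D}|^2}\big)\frac{E}{N_0}$ ($v$ the other user, $E$ the symbol energy) is detected first, by nulling the signal of $v$ and MRC; the other user is detected by MRC after the true signal of the first has been subtracted from the relay signal (no error propagation). For a user $u$ and an information bit $j$, let $P_{b,u}$ be the probability that the destination's decision on bit $j$ of $u$ is wrong, and let $p_0,p_1,p_2,p_3$ be the probabilities that the relay decodes correctly neither block, that of $u$ only, that of the other user only, both. For $s>0$ put $$U(s)=\tfrac12\Big[(p_0+p_2)\tfrac{\lambda}{s+\lambda}+p_1\big(\tfrac{\lambda}{s+\lambda}\big)^2\Big]+\tfrac{p_3}{4}\Big[\tfrac{\lambda\sqrt\pi}{s+\lambda}\Big(\tfrac{32\lambda^3F(3,\frac32;\frac52;\frac{s}{4\lambda+s})}{\Gamma(5/2)(4\lambda+s)^3}+\tfrac{4\lambda^2F(2,\frac12;\frac52;\frac{s}{4\lambda+s})}{\Gamma(5/2)(4\lambda+s)^2}\Big)+\big(\tfrac{\lambda}{s+\lambda}\big)^2\Big],$$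 with $F$ the Gauss hypergeometric function. **Statement (asymptotic behavior).** Let $\lambda>0$. 1. (Uncoded.) There are constants $\alpha,\beta,\gamma>0$ and a function $\rho$ with $\rho(s)=o\big((s+\lambda)^{-2}\big)$ as $s\to\infty$, depending only on $\lambda$, such that for all $s>0$ and all real $p_0,\dots,p_3$ $$U(s)=\alpha(p_0+p_2)\frac{\lambda}{s+\lambda}+\frac{\beta p_1+\gamma p_3}{(s+\lambda)^2}+p_3\,\rho(s);$$ moreover there is $s_0>0$, depending only on $\lambda$, such that for all $n,\lambda_R,N_0,u,j$ and all $\mathrm{snr}_0\ge s_0$, the probability $P_{b,u}$ is at most $U(\mathrm{snr}_0)$, hence at most the right-hand side at $s=\mathrm{snr}_0$ (with the above $p_i$). 2. (Coded.) For all $k_0,n_0,L,G$ as above there are constants $\alpha,\beta,\gamma>0$ and a function $\rho(s)=o\big((s+\lambda)^{-2}\big)$, depending only on $\lambda$, $G$ and $L$, such that for all $\lambda_R,N_0,u,j$, all Viterbi decoders and all $\mathrm{snr}_0>0$, with $s=\mathrm{snr}_0^c$, $$P_{b,u}\le\alpha(p_0+p_2)\frac{\lambda}{s+\lambda}+\frac{\beta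 p_1+\gamma p_3}{(s+\lambda)^2}+p_3\,\rho(s).$$ 3. (Diversity.) In both cases, for fixed $N_0$ and $\lambda_R$, as $\mathrm{snr}_0\to\infty$ one has $p_0,p_1,p_2\to0$ and $p_3\to1$, and both users have diversity order two: $-\log P_{b,u}/\log \mathrm{snr}_0\to2$. -/

import Mathlib

open Filter Topology MeasureTheory ProbabilityTheory Asymptotics
open scoped Polynomial ComplexConjugate

noncomputable section

namespace MARC

/-- The two users of the multiple access relay channel. -/
inductive User
  | A
  | B
  deriving DecidableEq

instance : Fintype User := ⟨{User.A, User.B}, fun u => by cases u <;> simp⟩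

/-- The user different from `u`. -/
def User.other : User → User
  | .A => .B
  | .B => .A

/-- The law of a circular zero-mean complex Gaussian variable `Z` with `E|Z|^2 = v`. -/
def complexGaussian (v : ℝ) : Measure ℂ :=
  ((gaussianReal 0 (v / 2).toNNReal).prod (gaussianReal 0 (v / 2).toNNReal)).map
    Complex.measurableEquivRealProd.symm

/-- One realization of everything that is random in the transmission of one block.  Each user has
an information block indexed by `κ` and transmits a block of symbols indexed by `ι`.  In order:
information bits of the users; gains user-destination; gain relay-destination; gains user-relay;
noises at the destination in the slots of the users; noise at the destination in the slot of
the relay; noises at the relay in the slots of the users. -/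
abbrev Sample (κ ι : Type) : Type :=
  (User → κ → ZMod 2) × (User → ℂ) × ℂ × (User → ℂ) ×
    (User → ι → ℂ) × (ι → ℂ) × (User → ι → ℂ)

namespace Sample

variable {κ ι : Type}

/-- Information bits. -/
def bits (ω : Sample κ ι) : User → κ → ZMod 2 := ω.1
/-- Gains of the links user-destination. -/
def hUD (ω : Sample κ ι) : User → ℂ := ω.2.1
/-- Gain of the link relay-destination. -/
def hRD (ω : Sample κ ι) : ℂ := ω.2.2.1
/-- Gains of the links user-relay. -/
def hUR (ω : Sample κ ι) : User → ℂ := ω.2.2.2.1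
/-- Noise at the destination while the users transmit. -/
def nUD (ω : Sample κ ι) : User → ι → ℂ := ω.2.2.2.2.1
/-- Noise at the destination while the relay transmits. -/
def nRD (ω : Sample κ ι) : ι → ℂ := ω.2.2.2.2.2.1
/-- Noise at the relay while the users transmit. -/
def nUR (ω : Sample κ ι) : User → ι → ℂ := ω.2.2.2.2.2.2

end Sample

/-- The joint law: all components are independent, the bits are uniform, the gains towards the
destination are complex Gaussian with `|h|^2` exponential of rate `lam`, the gains towards the
relay are complex Gaussian with `|h|^2` exponential of rate `lamR`, and the noises are complex
Gaussian of power `N0`.  The gains are constant during the block. -/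
def law (κ ι : Type) [Fintype κ] [Fintype ι] (lam lamR N0 : ℝ) : Measure (Sample κ ι) :=
  (uniformOn (Set.univ : Set (User → κ → ZMod 2))).prod <|
  (Measure.pi fun _ : User => complexGaussian (1 / lam)).prod <|
  (complexGaussian (1 / lam)).prod <|
  (Measure.pi fun _ : User => complexGaussian (1 / lamR)).prod <|
  (Measure.pi fun _ : User => Measure.pi fun _ : ι => complexGaussian N0).prod <|
  (Measure.pi fun _ : ι => complexGaussian N0).prod <|
  (Measure.pi fun _ : User => Measure.pi fun _ : ι => complexGaussian N0)

/-- An encoder of information blocks into blocks of code bits, and a hard-input decoder. -/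
structure Codec (κ ι : Type) where
  /-- encoder -/
  enc : (κ → ZMod 2) → ι → ZMod 2
  /-- decoder -/
  dec : (ι → ZMod 2) → κ → ZMod 2

/-- Uncoded transmission. -/
def Codec.uncoded (κ : Type) : Codec κ κ := ⟨id, id⟩

/-- BPSK with symbol energy `E`. -/
def bpsk (E : ℝ) (b : ZMod 2) : ℂ :=
  if b = 0 then ((√E : ℝ) : ℂ) else -((√E : ℝ) : ℂ)

/-- Coherent BPSK decision from the decision variable `T`. -/
def hardBit (T : ℂ) : ZMod 2 :=
  open Classical in if 0 ≤ T.re then 0 else 1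

section Scheme

variable {κ ι : Type} (C : Codec κ ι) (E N0 : ℝ) (ω : Sample κ ι)

/-- The block of symbols transmitted by user `u`. -/
def tx (u : User) (i : ι) : ℂ := bpsk E (C.enc (ω.bits u) i)

/-- Signal received by the relay from user `u`. -/
def relayRx (u : User) (i : ι) : ℂ := ω.hUR u * tx C E ω u i + ω.nUR u i

/-- The information block of user `u` as decoded by the relay. -/
def relayDecoded (u : User) : κ → ZMod 2 :=
  C.dec fun i => hardBit (conj (ω.hUR u) * relayRx C E ω u i)

/-- The relay has decoded the block of user `u` correctly (which it knows, by error detection). -/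
def RelayOK (u : User) : Prop := relayDecoded C E ω u = ω.bits u

/-- The relay adds the re-encoded and re-modulated blocks that it has decoded correctly; it is
silent if there is none. -/
def relayTx (i : ι) : ℂ :=
  open Classical in
  ∑ u : User, if RelayOK C E ω u then bpsk E (C.enc (relayDecoded C E ω u) i) else 0

/-- Signal received by the destination from user `u`. -/
def destRx (u : User) (i : ι) : ℂ := ω.hUD u * tx C E ω u i + ω.nUD u i

/-- Signal received by the destination from the relay. -/
def destRxRelay (i : ι) : ℂ := ω.hRD * relayTx C E ω i + ω.nRD i

/-- Gain of user `u` after the other user has been nulled out of the relay signal. -/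
def nulledGain (u : User) : ℂ :=
  ω.hRD * ω.hUD u.other / ((√(‖ω.hUD u.other‖ ^ 2 + ‖ω.hRD‖ ^ 2) : ℝ) : ℂ)

/-- The combination of the received signals in which the signal of the user other than `u` is
nulled: projection on the unit vector orthogonal to the direction of that user. -/
def nulledRx (u : User) (i : ι) : ℂ :=
  (ω.hUD u.other * destRxRelay C E ω i - ω.hRD * destRx C E ω u.other i) /
    ((√(‖ω.hUD u.other‖ ^ 2 + ‖ω.hRD‖ ^ 2) : ℝ) : ℂ)

/-- SNR of user `u` after nulling and maximum ratio combining. -/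
def nulledSNR (u : User) : ℝ :=
  (‖ω.hUD u‖ ^ 2 +
    ‖ω.hUD u.other * ω.hRD‖ ^ 2 / (‖ω.hUD u.other‖ ^ 2 + ‖ω.hRD‖ ^ 2)) * (E / N0)

/-- The decision variable of the destination for the `i`-th symbol of user `u`, in the
error-propagation-free case.  If the relay forwards both blocks, the user with the higher SNR
is detected first, by nulling and maximum ratio combining; for the second user the (correct)
signal of the first one is subtracted from the relay signal, before maximum ratio combining.
If the relay forwards the block of `u` only, it is maximum ratio combining; otherwise it is
direct detection. -/
def decisionVar (u : User) (i : ι) : ℂ :=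
  open Classical in
  if RelayOK C E ω u then
    if RelayOK C E ω u.other then
      if nulledSNR E N0 ω u.other ≤ nulledSNR E N0 ω u then
        conj (ω.hUD u) * destRx C E ω u i + conj (nulledGain ω u) * nulledRx C E ω u i
      else
        conj (ω.hUD u) * destRx C E ω u i +
          conj ω.hRD * (destRxRelay C E ω i - ω.hRD * tx C E ω u.other i)
    else conj (ω.hUD u) * destRx C E ω u i + conj ω.hRD * destRxRelay C E ω i
  else conj (ω.hUD u) * destRx C E ω u i

/-- The information block of user `u` as decoded by the destination. -/
def destDecoded (u : User) : κ → ZMod 2 :=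
  C.dec fun i => hardBit (decisionVar C E N0 ω u i)

end Scheme

section Probabilities

variable {κ ι : Type} [Fintype κ] [Fintype ι]

/-- Bit error probability of the `j`-th information bit of user `u`. -/
def bep (C : Codec κ ι) (lam lamR E N0 : ℝ) (u : User) (j : κ) : ℝ :=
  (law κ ι lam lamR N0).real {ω | destDecoded C E N0 ω u j ≠ ω.bits u j}

/-- The probabilities `p₀, p₁, p₂, p₃` of the relay states, seen from user `u`: the relay has
decoded neither block, that of `u` only, that of the other user only, both. -/
def stateProb (C : Codec κ ι) (lam lamR E N0 : ℝ) (u : User) : Fin 4 → ℝ :=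
  ![(law κ ι lam lamR N0).real {ω | ¬ RelayOK C E ω u ∧ ¬ RelayOK C E ω u.other},
    (law κ ι lam lamR N0).real {ω | RelayOK C E ω u ∧ ¬ RelayOK C E ω u.other},
    (law κ ι lam lamR N0).real {ω | ¬ RelayOK C E ω u ∧ RelayOK C E ω u.other},
    (law κ ι lam lamR N0).real {ω | RelayOK C E ω u ∧ RelayOK C E ω u.other}]

end Probabilities

/-- The upper bound on the bit error probability of the uncoded scheme, at SNR `s`. -/
def bepBound (lam : ℝ) (p : Fin 4 → ℝ) (s : ℝ) : ℝ :=
  1 / 2 * ((p 0 + p 2) * (lam / (s + lam)) + p 1 * (lam / (s + lam)) ^ 2) +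
  p 3 / 4 *
    (lam / (s + lam) * √Real.pi *
      (32 * lam ^ 3 / (Real.Gamma 2.5 * (4 * lam + s) ^ 3) *
          ordinaryHypergeometric (3 : ℝ) 1.5 2.5 (s / (4 * lam + s)) +
        4 * lam ^ 2 / (Real.Gamma 2.5 * (4 * lam + s) ^ 2) *
          ordinaryHypergeometric (2 : ℝ) 0.5 2.5 (s / (4 * lam + s))) +
      (lam / (s + lam)) ^ 2)

/-- `α (p₀ + p₂) λ / (s + λ) + (β p₁ + γ p₃) / (s + λ)² + p₃ ρ(s)`. -/
def asymptoticForm (α β γ : ℝ) (ρ : ℝ → ℝ) (lam : ℝ) (p : Fin 4 → ℝ) (s : ℝ) : ℝ :=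
  α * (p 0 + p 2) * (lam / (s + lam)) + (β * p 1 + γ * p 3) * (1 / (s + lam)) ^ 2 + p 3 * ρ s

/-- The error probability `Pe`, a function of the SNR, has diversity order `d`. -/
def HasDiversityOrder (Pe : ℝ → ℝ) (d : ℝ) : Prop :=
  Tendsto (fun s => -Real.log (Pe s) / Real.log s) atTop (𝓝 d)

section Convolutional

variable {k₀ n₀ : ℕ} (G : Matrix (Fin k₀) (Fin n₀) (ZMod 2)[X])

/-- Memory of the convolutional encoder with polynomial generator matrix `G`. -/
def memory : ℕ := Finset.univ.sup fun a => Finset.univ.sup fun i => (G a i).natDegree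

/-- Terminated convolutional encoding: `L` input frames of `k₀` bits, followed by `memory G` zero
frames, give `L + memory G` output frames of `n₀` bits. -/
def convEnc (L : ℕ) (b : Fin L × Fin k₀ → ZMod 2) (x : Fin (L + memory G) × Fin n₀) : ZMod 2 :=
  (∑ a : Fin k₀, (∑ t : Fin L, Polynomial.C (b (t, a)) * Polynomial.X ^ (t : ℕ)) * G a x.2).coeff
    (x.1 : ℕ)

/-- Free distance: the least Hamming weight of a nonzero code sequence. -/
def freeDist : ℕ :=
  sInf {w | ∃ u : Fin k₀ → PowerSeries (ZMod 2),
    let S := {x : ℕ × Fin n₀ |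
      PowerSeries.coeff x.1 (∑ a, u a * ((G a x.2 : (ZMod 2)[X]) : PowerSeries (ZMod 2))) ≠ 0}
    S.Nonempty ∧ S.Finite ∧ S.ncard = w}

/-- A hard-input Viterbi decoder: it returns an information block whose code word has minimal
Hamming distance to its input (ties may be broken in any way). -/
def IsViterbi {κ ι : Type} [Fintype ι] (C : Codec κ ι) : Prop :=
  ∀ y b, hammingDist y (C.enc (C.dec y)) ≤ hammingDist y (C.enc b)

end Convolutional

end MARC

end

/-!
Write `X`, `Y`, `Z` for the squared gains `|h_{u,D}|²`, `|h_{v,D}|²`, `|h_{R,D}|²`, which are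
independent exponential variables, and `s` for the SNR `E / N₀` of a symbol.

In each state of the relay the decision variables of the destination have the form
`G x_i + (noise)`, where the combination of the three noises has a coefficient vector of squared
norm `G` (`destDecoded_of_not` and its companions).  Given the gains, the real parts of the noises
are therefore independent Gaussian variables of variance `G N₀ / 2` (`noiseLaw_map_re`), and a hard
decision is wrong with probability `Q(√(2 s G))`.  Here `G` is `X` for direct detection, `X + Z` for
maximum ratio combining, and at least `X` after nulling; the user with the larger SNR after nulling
is simply the one with the larger direct gain (`norm_sq_le_of_nulledSNR_le`), so nulling occurs
only on `Y ≤ X`.  Given the bits, the state of the relay is independent of what the destination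
sees (`law_separate_le`).  Hence a bound of the error probability at the combined gain `G` by a sum
of terms `c e^{-tG}` gives a bound on the bit error probability of the scheme (`bep_le`), by the
three averages `E e^{-tX}`, `E e^{-t(X+Z)}` and `E[e^{-tX}; Y ≤ X]`.

* Uncoded transmission.  The bound `Q(x) ≤ e^{-x²/2} / 2` is not sufficient for the coefficient of
  `p₃`: even with the exact SNR after nulling, both sides would have the leading term
  `3 λ² / (4 s²)`.  The bound
  `Q(x) ≤ (e^{-x²/2} + e^{-x²}) / 4` (`integral_Ioi_exp_neg_half_sq_le`) gives `5 λ² / (8 s²)`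
  instead, which is smaller for large `s` (`eventually_le_bothForwardedBound`).  The leading term of
  the explicit bound follows from the power series of the two hypergeometric functions at `1`
  (`tendsto_bothForwardedBound`).
* Coded transmission.  If Viterbi decoding fails, at least `d / 2` hard decisions are wrong, where
  `d` is the minimum distance; a union bound over the sets of wrong positions gives
  `2 ^ (block length) * e^{-s G d / 2}` (`combinedNoise_viterbi_le`), and `d` is at least the free
  distance (`freeDist_le_hammingDist`).
* Diversity.  The relay fails with probability `O(1 / s)`, and then an error at the destination has
  probability `O(1 / s)`; the other contributions are `O(1 / s²)`.  Conversely, with probability of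
  the order of `1 / s` the link of `u` to the relay is in a deep fade, in which every pattern of hard
  decisions has a probability bounded below, and independently the same holds for the direct link
  (`exists_le_bep`).
-/

namespace MARC

open scoped NNReal ENNReal

/-! ### The hypergeometric functions of the bound -/

lemma hypergeometric_coeff_three (n : ℕ) :
    ((n.factorial : ℝ)⁻¹ * (ascPochhammer ℝ n).eval 3 * (ascPochhammer ℝ n).eval 1.5 *
      ((ascPochhammer ℝ n).eval 2.5)⁻¹) = 3 / 4 * ((n + 1) * (n + 2) / (n + 3 / 2)) := by
  induction n with
  | zero => norm_num
  | succ n ih =>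
    rw [ascPochhammer_succ_eval, ascPochhammer_succ_eval, ascPochhammer_succ_eval,
      Nat.factorial_succ]
    have e : (((n + 1) * n.factorial : ℕ) : ℝ)⁻¹ * ((ascPochhammer ℝ n).eval 3 * (3 + n)) *
        ((ascPochhammer ℝ n).eval 1.5 * (1.5 + n)) *
        ((ascPochhammer ℝ n).eval 2.5 * (2.5 + n))⁻¹ =
        ((n.factorial : ℝ)⁻¹ * (ascPochhammer ℝ n).eval 3 * (ascPochhammer ℝ n).eval 1.5 *
      ((ascPochhammer ℝ n).eval 2.5)⁻¹) * ((3 + n) * (1.5 + n) / ((n + 1) * (2.5 + n))) := by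
      push_cast
      rw [mul_inv, mul_inv, div_eq_mul_inv, mul_inv]
      ring
    rw [e, ih]
    push_cast
    have h1 : (n : ℝ) + 3 / 2 ≠ 0 := by positivity
    have h2 : (n : ℝ) + 1 + 3 / 2 ≠ 0 := by positivity
    have h3 : (2.5 : ℝ) + n ≠ 0 := by positivity
    have h4 : (n : ℝ) + 1 ≠ 0 := by positivity
    field_simp
    ring

lemma hypergeometric_coeff_two (n : ℕ) :
    ((n.factorial : ℝ)⁻¹ * (ascPochhammer ℝ n).eval 2 * (ascPochhammer ℝ n).eval 0.5 *
      ((ascPochhammer ℝ n).eval 2.5)⁻¹) = 3 / 4 * ((n + 1) / ((n + 1 / 2) * (n + 3 / 2))) := by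
  induction n with
  | zero => norm_num
  | succ n ih =>
    rw [ascPochhammer_succ_eval, ascPochhammer_succ_eval, ascPochhammer_succ_eval,
      Nat.factorial_succ]
    have e : (((n + 1) * n.factorial : ℕ) : ℝ)⁻¹ * ((ascPochhammer ℝ n).eval 2 * (2 + n)) *
        ((ascPochhammer ℝ n).eval 0.5 * (0.5 + n)) *
        ((ascPochhammer ℝ n).eval 2.5 * (2.5 + n))⁻¹ =
        ((n.factorial : ℝ)⁻¹ * (ascPochhammer ℝ n).eval 2 * (ascPochhammer ℝ n).eval 0.5 *
      ((ascPochhammer ℝ n).eval 2.5)⁻¹) * ((2 + n) * (0.5 + n) / ((n + 1) * (2.5 + n))) := by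
      push_cast
      rw [mul_inv, mul_inv, div_eq_mul_inv, mul_inv]
      ring
    rw [e, ih]
    push_cast
    have h1 : (n : ℝ) + 3 / 2 ≠ 0 := by positivity
    have h0 : (n : ℝ) + 1 / 2 ≠ 0 := by positivity
    have h5 : (n : ℝ) + 1 + 1 / 2 ≠ 0 := by positivity
    have h2 : (n : ℝ) + 1 + 3 / 2 ≠ 0 := by positivity
    have h3 : (2.5 : ℝ) + n ≠ 0 := by positivity
    have h4 : (n : ℝ) + 1 ≠ 0 := by positivity
    field_simp
    ring

lemma hasSum_succ_mul_geometric {z : ℝ} (h0 : 0 ≤ z) (h1 : z < 1) :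
    HasSum (fun n : ℕ => ((n : ℝ) + 1) * z ^ n) (1 / (1 - z) ^ 2) := by
  have := hasSum_choose_mul_geometric_of_norm_lt_one (𝕜 := ℝ) 1
    (by rwa [Real.norm_eq_abs, abs_of_nonneg h0] : ‖z‖ < 1)
  simpa using this

lemma hypergeometric_three_mem_Icc {z : ℝ} (h0 : 0 ≤ z) (h1 : z < 1) :
    ordinaryHypergeometric (3 : ℝ) 1.5 2.5 z ∈
      Set.Icc (3 / 4 * (1 / (1 - z) ^ 2)) (3 / 4 * (1 / (1 - z) ^ 2 + 1 / 2 * (1 / (1 - z)))) := by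
  rw [ordinaryHypergeometric_eq_tsum]
  simp only [hypergeometric_coeff_three, smul_eq_mul]
  have s1 := (hasSum_succ_mul_geometric h0 h1).mul_left (3 / 4)
  have s2 : HasSum (fun n : ℕ => 3 / 4 * (((n : ℝ) + 1) * z ^ n + 1 / 2 * z ^ n))
      (3 / 4 * (1 / (1 - z) ^ 2 + 1 / 2 * (1 / (1 - z)))) := by
    have := (hasSum_geometric_of_lt_one h0 h1).mul_left (1 / 2)
    rw [← one_div] at this
    exact ((hasSum_succ_mul_geometric h0 h1).add this).mul_left (3 / 4)
  have lb (n : ℕ) : 3 / 4 * (((n : ℝ) + 1) * z ^ n) ≤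
      3 / 4 * (((n : ℝ) + 1) * (n + 2) / (n + 3 / 2)) * z ^ n := by
    have : (n : ℝ) + 1 ≤ ((n : ℝ) + 1) * (n + 2) / (n + 3 / 2) := by
      rw [le_div_iff₀ (by positivity)]; nlinarith [Nat.cast_nonneg (α := ℝ) n]
    have := mul_le_mul_of_nonneg_right this (pow_nonneg h0 n)
    linarith
  have ub (n : ℕ) : 3 / 4 * (((n : ℝ) + 1) * (n + 2) / (n + 3 / 2)) * z ^ n ≤
      3 / 4 * (((n : ℝ) + 1) * z ^ n + 1 / 2 * z ^ n) := by
    have : ((n : ℝ) + 1) * (n + 2) / (n + 3 / 2) ≤ (n + 1) + 1 / 2 := by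
      rw [div_le_iff₀ (by positivity)]; nlinarith [Nat.cast_nonneg (α := ℝ) n]
    have := mul_le_mul_of_nonneg_right this (pow_nonneg h0 n)
    linarith
  have sm : Summable fun n : ℕ => 3 / 4 * (((n : ℝ) + 1) * (n + 2) / (n + 3 / 2)) * z ^ n :=
    Summable.of_nonneg_of_le (fun n => by positivity) ub s2.summable
  exact ⟨hasSum_le lb s1 sm.hasSum, hasSum_le ub sm.hasSum s2⟩

/-- The coefficients of `F(2, 1/2; 5/2; z)` decay like `1 / n`, so the singularity at `1` is only
logarithmic. -/
lemma hypergeometric_two_mem_Icc {z : ℝ} (h0 : 0 < z) (h1 : z < 1) :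
    ordinaryHypergeometric (2 : ℝ) 0.5 2.5 z ∈ Set.Icc 0 (-Real.log (1 - z) / z) := by
  rw [ordinaryHypergeometric_eq_tsum]
  simp only [hypergeometric_coeff_two, smul_eq_mul]
  have s2 : HasSum (fun n : ℕ => z ^ n / ((n : ℝ) + 1)) (-Real.log (1 - z) / z) := by
    have := (Real.hasSum_pow_div_log_of_abs_lt_one (by rwa [abs_of_pos h0] : |z| < 1)).div_const z
    refine this.congr_fun fun n => ?_
    rw [pow_succ]
    field_simp
  have ub (n : ℕ) : 3 / 4 * (((n : ℝ) + 1) / ((n + 1 / 2) * (n + 3 / 2))) * z ^ n ≤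
      z ^ n / ((n : ℝ) + 1) := by
    have : 3 / 4 * (((n : ℝ) + 1) / ((n + 1 / 2) * (n + 3 / 2))) ≤ 1 / ((n : ℝ) + 1) := by
      rw [← mul_div_assoc, div_le_div_iff₀ (by positivity) (by positivity)]
      nlinarith [Nat.cast_nonneg (α := ℝ) n, sq_nonneg (n : ℝ)]
    have := mul_le_mul_of_nonneg_right this (pow_nonneg h0.le n)
    calc _ ≤ _ := this
      _ = _ := by ring
  have nn (n : ℕ) : 0 ≤ 3 / 4 * (((n : ℝ) + 1) / ((n + 1 / 2) * (n + 3 / 2))) * z ^ n := by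
    positivity
  have sm := Summable.of_nonneg_of_le nn ub s2.summable
  exact ⟨tsum_nonneg nn, hasSum_le ub sm.hasSum s2⟩

/-- The coefficient of `p 3` in `bepBound`. -/
noncomputable def bothForwardedBound (lam s : ℝ) : ℝ :=
  1 / 4 *
    (lam / (s + lam) * √Real.pi *
      (32 * lam ^ 3 / (Real.Gamma 2.5 * (4 * lam + s) ^ 3) *
          ordinaryHypergeometric (3 : ℝ) 1.5 2.5 (s / (4 * lam + s)) +
        4 * lam ^ 2 / (Real.Gamma 2.5 * (4 * lam + s) ^ 2) *
          ordinaryHypergeometric (2 : ℝ) 0.5 2.5 (s / (4 * lam + s))) +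
      (lam / (s + lam)) ^ 2)

lemma Gamma_five_halves : Real.Gamma 2.5 = 3 / 4 * √Real.pi := by
  have h := Real.Gamma_nat_add_half 2
  norm_num [Nat.doubleFactorial] at h ⊢
  rw [h]; ring

lemma tendsto_one_sub_sq_mul_hypergeometric_three :
    Tendsto (fun w : ℝ => w ^ 2 * ordinaryHypergeometric (3 : ℝ) 1.5 2.5 (1 - w)) (𝓝[>] 0)
      (𝓝 (3 / 4)) := by
  have hev : ∀ᶠ w : ℝ in 𝓝[>] 0, 0 < w ∧ w < 1 := Ioo_mem_nhdsGT one_pos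
  have hu : Tendsto (fun w : ℝ => 3 / 4 * (1 + 1 / 2 * w)) (𝓝[>] 0) (𝓝 (3 / 4)) := by
    have : Tendsto (fun w : ℝ => 3 / 4 * (1 + 1 / 2 * w)) (𝓝 0) (𝓝 (3 / 4 * (1 + 1 / 2 * 0))) :=
      Continuous.tendsto (by fun_prop) 0
    simpa using this.mono_left nhdsWithin_le_nhds
  refine tendsto_of_tendsto_of_tendsto_of_le_of_le' tendsto_const_nhds hu ?_ ?_
  · filter_upwards [hev] with w ⟨h0, h1⟩
    have := (hypergeometric_three_mem_Icc (z := 1 - w) (by linarith) (by linarith)).1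
    rw [sub_sub_cancel] at this
    calc (3 / 4 : ℝ) = w ^ 2 * (3 / 4 * (1 / w ^ 2)) := by field_simp
      _ ≤ _ := by gcongr
  · filter_upwards [hev] with w ⟨h0, h1⟩
    have := (hypergeometric_three_mem_Icc (z := 1 - w) (by linarith) (by linarith)).2
    rw [sub_sub_cancel] at this
    calc _ ≤ w ^ 2 * (3 / 4 * (1 / w ^ 2 + 1 / 2 * (1 / w))) := by gcongr
      _ = _ := by field_simp

lemma tendsto_one_sub_mul_hypergeometric_two :
    Tendsto (fun w : ℝ => w * ordinaryHypergeometric (2 : ℝ) 0.5 2.5 (1 - w)) (𝓝[>] 0)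
      (𝓝 0) := by
  have hev : ∀ᶠ w : ℝ in 𝓝[>] 0, 0 < w ∧ w < 1 := Ioo_mem_nhdsGT one_pos
  have hu : Tendsto (fun w : ℝ => Real.negMulLog w / (1 - w)) (𝓝[>] 0) (𝓝 0) := by
    have h1 : Tendsto Real.negMulLog (𝓝[>] 0) (𝓝 (Real.negMulLog 0)) :=
      (Real.continuous_negMulLog.tendsto 0).mono_left nhdsWithin_le_nhds
    have h2 : Tendsto (fun w : ℝ => 1 - w) (𝓝[>] 0) (𝓝 (1 - 0)) :=
      (Continuous.tendsto (by fun_prop) 0).mono_left nhdsWithin_le_nhds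
    simpa [Pi.div_def] using h1.div h2 (by norm_num)
  refine tendsto_of_tendsto_of_tendsto_of_le_of_le' tendsto_const_nhds hu ?_ ?_
  · filter_upwards [hev] with w ⟨h0, h1⟩
    exact mul_nonneg h0.le (hypergeometric_two_mem_Icc (z := 1 - w) (by linarith) (by linarith)).1
  · filter_upwards [hev] with w ⟨h0, h1⟩
    have := (hypergeometric_two_mem_Icc (z := 1 - w) (by linarith) (by linarith)).2
    rw [sub_sub_cancel] at this
    calc _ ≤ w * (-Real.log w / (1 - w)) := by gcongr
      _ = _ := by rw [Real.negMulLog]; ring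

lemma tendsto_bothForwardedBound {lam : ℝ} (hlam : 0 < lam) :
    Tendsto (fun s => (s + lam) ^ 2 * bothForwardedBound lam s) atTop (𝓝 (3 / 4 * lam ^ 2)) := by
  have hw : Tendsto (fun s : ℝ => 4 * lam / (4 * lam + s)) atTop (𝓝[>] 0) := by
    refine tendsto_nhdsWithin_iff.2 ⟨?_, ?_⟩
    · exact (tendsto_atTop_add_const_left _ _ tendsto_id).const_div_atTop _
    · filter_upwards [eventually_gt_atTop 0] with s hs
      exact (div_pos (by linarith) (by linarith) : (0 : ℝ) < 4 * lam / (4 * lam + s))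
  have hq : Tendsto (fun s : ℝ => (s + lam) / (4 * lam + s)) atTop (𝓝 1) := by
    have h0 : Tendsto (fun s : ℝ => 1 - 3 / 4 * (4 * lam / (4 * lam + s))) atTop
        (𝓝 (1 - 3 / 4 * 0)) :=
      tendsto_const_nhds.sub (tendsto_const_nhds.mul (hw.mono_right nhdsWithin_le_nhds))
    rw [mul_zero, sub_zero] at h0
    refine h0.congr' ?_
    filter_upwards [eventually_gt_atTop 0] with s hs
    field_simp
    ring
  have h3 := tendsto_one_sub_sq_mul_hypergeometric_three.comp hw
  have h2 := tendsto_one_sub_mul_hypergeometric_two.comp hw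
  have hpi : 0 < √Real.pi := Real.sqrt_pos.2 Real.pi_pos
  have key := (((hq.mul h3).const_mul (8 / 3 * lam ^ 2)).add
    ((hq.mul h2).const_mul (4 / 3 * lam ^ 2))).add_const (lam ^ 2) |>.const_mul (1 / 4)
  have e : 1 / 4 * (8 / 3 * lam ^ 2 * (1 * (3 / 4)) + 4 / 3 * lam ^ 2 * (1 * 0) + lam ^ 2) =
    3 / 4 * lam ^ 2 := by ring
  rw [e] at key
  refine key.congr' ?_
  filter_upwards [eventually_gt_atTop 0] with s hs
  have hz : 1 - 4 * lam / (4 * lam + s) = s / (4 * lam + s) := by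
    field_simp; ring
  simp only [Function.comp, hz, bothForwardedBound, Gamma_five_halves]
  field_simp
  ring

/-! ### Tails of the real Gaussian law -/

lemma monotone_add_two_mul_exp :
    Monotone fun x : ℝ => x + 2 * x * Real.exp (-x ^ 2 / 2) := by
  have hd (x : ℝ) : HasDerivAt (fun x : ℝ => x + 2 * x * Real.exp (-x ^ 2 / 2))
      (1 + 2 * (1 - x ^ 2) * Real.exp (-x ^ 2 / 2)) x := by
    have h1 : HasDerivAt (fun x : ℝ => -x ^ 2 / 2) (-x) x := by
      exact ((hasDerivAt_pow 2 x).neg.div_const 2).congr_deriv (by norm_num; try ring)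
    refine ((hasDerivAt_id x).add (((hasDerivAt_id x).const_mul 2).mul h1.exp)).congr_deriv ?_
    simp only [id]
    ring
  refine monotone_of_deriv_nonneg (fun x => (hd x).differentiableAt) fun x => ?_
  rw [(hd x).deriv]
  -- `exp u ≥ 4 u - 2`, by the tangent at `log 4`
  have h4 : 4 * (x ^ 2 / 2) - 2 ≤ Real.exp (x ^ 2 / 2) := by
    have h := Real.add_one_le_exp (x ^ 2 / 2 - 2 * Real.log 2)
    rw [Real.exp_sub, show 2 * Real.log 2 = Real.log 4 by
      rw [show (4 : ℝ) = 2 ^ 2 by norm_num, Real.log_pow]; norm_num,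
      Real.exp_log (by norm_num), show Real.log 4 = 2 * Real.log 2 by
      rw [show (4 : ℝ) = 2 ^ 2 by norm_num, Real.log_pow]; norm_num] at h
    have := Real.log_two_lt_d9
    linarith
  have hm : Real.exp (x ^ 2 / 2) * Real.exp (-x ^ 2 / 2) = 1 := by
    rw [← Real.exp_add]; simp [neg_div]
  have := mul_le_mul_of_nonneg_right h4 (Real.exp_pos (-x ^ 2 / 2)).le
  rw [hm] at this
  linarith

lemma integrable_exp_neg_half_sq : Integrable fun t : ℝ => Real.exp (-t ^ 2 / 2) := by
  have := integrable_exp_neg_mul_sq (b := 1 / 2) (by norm_num)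
  refine this.congr (ae_of_all _ fun t => ?_)
  simp only; congr 1; ring

/-- The bound of the Gaussian tail by two exponentials.  The sign of the derivative of the
difference of the two sides is that of an antitone function, so the difference, which vanishes
at `0` and at infinity, is nonnegative. -/
lemma integral_Ioi_exp_neg_half_sq_le {x : ℝ} (hx : 0 ≤ x) :
    ∫ t in Set.Ioi x, Real.exp (-t ^ 2 / 2) ≤
      √(2 * Real.pi) / 4 * (Real.exp (-x ^ 2 / 2) + Real.exp (-x ^ 2)) := by
  set k := √(2 * Real.pi) with hk
  have hk0 : 0 ≤ k := Real.sqrt_nonneg _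
  set J : ℝ → ℝ := fun x => ∫ t in (0 : ℝ)..x, Real.exp (-t ^ 2 / 2) with hJ
  have hint := integrable_exp_neg_half_sq
  have hcont : Continuous fun t : ℝ => Real.exp (-t ^ 2 / 2) := by fun_prop
  have h0 : ∫ t in Set.Ioi (0 : ℝ), Real.exp (-t ^ 2 / 2) = k / 2 := by
    have := integral_gaussian_Ioi (1 / 2)
    rw [show Real.pi / (1 / 2) = 2 * Real.pi by ring] at this
    rw [hk, ← this]
    congr 1; ext t; congr 1; ring
  have hT (y : ℝ) : ∫ t in Set.Ioi y, Real.exp (-t ^ 2 / 2) = k / 2 - J y := by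
    rw [← h0, hJ]
    have := intervalIntegral.integral_Ioi_sub_Ioi' (a := 0) (b := y) (μ := volume)
      (f := fun t : ℝ => Real.exp (-t ^ 2 / 2)) hint.integrableOn hint.integrableOn
    simp only; linarith
  rw [hT]
  set g : ℝ → ℝ := fun x => k / 4 * (Real.exp (-x ^ 2 / 2) + Real.exp (-x ^ 2)) - (k / 2 - J x)
    with hg
  suffices 0 ≤ g x by rw [hg] at this; simp only at this; linarith
  have hg0 : g 0 = 0 := by simp [hg, hJ]; ring
  have hJlim : Tendsto J atTop (𝓝 (k / 2)) := by
    rw [← h0]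
    exact intervalIntegral_tendsto_integral_Ioi 0 hint.integrableOn tendsto_id
  have hglim : Tendsto g atTop (𝓝 0) := by
    have hsq : Tendsto (fun x : ℝ => x ^ 2) atTop atTop := tendsto_pow_atTop (by norm_num)
    have e1 : Tendsto (fun x : ℝ => Real.exp (-x ^ 2)) atTop (𝓝 0) :=
      Real.tendsto_exp_atBot.comp (tendsto_neg_atTop_atBot.comp hsq)
    have e2 : Tendsto (fun x : ℝ => Real.exp (-x ^ 2 / 2)) atTop (𝓝 0) :=
      Real.tendsto_exp_atBot.comp
        ((tendsto_neg_atTop_atBot.comp hsq).atBot_div_const (by norm_num))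
    have := ((e2.add e1).const_mul (k / 4)).sub (hJlim.const_sub (k / 2))
    simpa using this
  have hdg (y : ℝ) : HasDerivAt g (Real.exp (-y ^ 2 / 2) *
      (1 - k / 4 * (y + 2 * y * Real.exp (-y ^ 2 / 2)))) y := by
    have h1 : HasDerivAt (fun x : ℝ => -x ^ 2 / 2) (-y) y := by
      exact ((hasDerivAt_pow 2 y).neg.div_const 2).congr_deriv (by norm_num; try ring)
    have h2 : HasDerivAt (fun x : ℝ => -x ^ 2) (-(2 * y)) y := by
      exact (hasDerivAt_pow 2 y).neg.congr_deriv (by norm_num; try ring)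
    have h3 : HasDerivAt J (Real.exp (-y ^ 2 / 2)) y :=
      intervalIntegral.integral_hasDerivAt_right hint.intervalIntegrable
        (hcont.stronglyMeasurableAtFilter _ _) hcont.continuousAt
    refine (((h1.exp.add h2.exp).const_mul (k / 4)).sub (h3.const_sub (k / 2))).congr_deriv ?_
    rw [show Real.exp (-y ^ 2) = Real.exp (-y ^ 2 / 2) * Real.exp (-y ^ 2 / 2) by
      rw [← Real.exp_add]; congr 1; ring]
    ring
  have hB : Antitone fun y : ℝ => 1 - k / 4 * (y + 2 * y * Real.exp (-y ^ 2 / 2)) := by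
    intro a b hab
    have := mul_le_mul_of_nonneg_left (monotone_add_two_mul_exp hab) (by positivity : 0 ≤ k / 4)
    simp only at this ⊢
    linarith
  have hgc : Continuous g := continuous_iff_continuousAt.2 fun y => (hdg y).continuousAt
  rcases le_or_gt 0 (1 - k / 4 * (x + 2 * x * Real.exp (-x ^ 2 / 2))) with hs | hs
  · have hm : MonotoneOn g (Set.Icc 0 x) := by
      refine monotoneOn_of_deriv_nonneg (convex_Icc 0 x) hgc.continuousOn
        (fun y _ => (hdg y).differentiableAt.differentiableWithinAt) fun y hy => ?_
      rw [interior_Icc] at hy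
      rw [(hdg y).deriv]
      exact mul_nonneg (Real.exp_pos _).le (hs.trans (hB hy.2.le))
    rw [← hg0]
    exact hm (Set.left_mem_Icc.2 hx) (Set.right_mem_Icc.2 hx) hx
  · have hm : AntitoneOn g (Set.Ici x) := by
      refine antitoneOn_of_deriv_nonpos (convex_Ici x) hgc.continuousOn
        (fun y _ => (hdg y).differentiableAt.differentiableWithinAt) fun y hy => ?_
      rw [interior_Ici] at hy
      rw [(hdg y).deriv]
      exact mul_nonpos_of_nonneg_of_nonpos (Real.exp_pos _).le ((hB (le_of_lt hy)).trans hs.le)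
    refine le_of_tendsto hglim ?_
    filter_upwards [eventually_ge_atTop x] with y hy
    exact hm Set.self_mem_Ici hy hy

lemma gaussianReal_std_Ici_le {x : ℝ} (hx : 0 ≤ x) :
    gaussianReal 0 1 (Set.Ici x) ≤
      ENNReal.ofReal (1 / 4 * Real.exp (-x ^ 2 / 2) + 1 / 4 * Real.exp (-x ^ 2)) := by
  rw [gaussianReal_apply_eq_integral 0 one_ne_zero, integral_Ici_eq_integral_Ioi]
  refine ENNReal.ofReal_le_ofReal ?_
  have hk : 0 < √(2 * Real.pi) := Real.sqrt_pos.2 (by positivity)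
  have : ∀ t, gaussianPDFReal 0 1 t = (√(2 * Real.pi))⁻¹ * Real.exp (-t ^ 2 / 2) := by
    intro t; simp [gaussianPDFReal]
  simp_rw [this]
  rw [integral_const_mul]
  calc _ ≤ (√(2 * Real.pi))⁻¹ *
        (√(2 * Real.pi) / 4 * (Real.exp (-x ^ 2 / 2) + Real.exp (-x ^ 2))) := by
        gcongr; exact integral_Ioi_exp_neg_half_sq_le hx
    _ = _ := by field_simp

lemma gaussianReal_eq_map_std (v : ℝ≥0) :
    gaussianReal 0 v = (gaussianReal 0 1).map (fun x => √(v : ℝ) * x) := by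
  rw [gaussianReal_map_const_mul]
  congr 1
  · simp
  · ext; simp [Real.sq_sqrt]

lemma gaussianReal_Ici_le {v : ℝ≥0} (hv : v ≠ 0) {m : ℝ} (hm : 0 ≤ m) :
    gaussianReal 0 v (Set.Ici m) ≤ ENNReal.ofReal
      (1 / 4 * Real.exp (-(m ^ 2 / (2 * v))) + 1 / 4 * Real.exp (-(m ^ 2 / v))) := by
  have hv' : 0 < √(v : ℝ) := Real.sqrt_pos.2 (by positivity)
  have hs : (fun x => √(v : ℝ) * x) ⁻¹' Set.Ici m = Set.Ici (m / √(v : ℝ)) := by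
    ext x; simp [div_le_iff₀' hv']
  rw [gaussianReal_eq_map_std, Measure.map_apply (by fun_prop) measurableSet_Ici, hs]
  refine (gaussianReal_std_Ici_le (by positivity)).trans_eq ?_
  rw [div_pow, Real.sq_sqrt v.coe_nonneg]
  congr 4
  ring

/-- Both tails: the law is symmetric. -/
lemma gaussianReal_Iic_neg (v : ℝ≥0) (m : ℝ) :
    gaussianReal 0 v (Set.Iic (-m)) = gaussianReal 0 v (Set.Ici m) := by
  have h := gaussianReal_map_neg (μ := 0) (v := v)
  rw [neg_zero] at h
  conv_lhs => rw [← h]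
  rw [Measure.map_apply measurable_neg measurableSet_Iic]
  congr 1; ext x; simp

/-- The tail of the Gaussian law beyond a bounded multiple of the standard deviation is bounded
below. -/
lemma exists_le_gaussianReal_Ioi (K : ℝ) :
    ∃ q : ℝ≥0∞, 0 < q ∧ q ≤ 1 ∧ ∀ (v : ℝ≥0) (m : ℝ), v ≠ 0 → m ^ 2 ≤ K ^ 2 * v →
      q ≤ gaussianReal 0 v (Set.Ioi m) ∧ q ≤ gaussianReal 0 v (Set.Iio (-m)) := by
  refine ⟨gaussianReal 0 1 (Set.Ioi |K|), ?_, prob_le_one, fun v m hv hm => ?_⟩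
  · refine pos_iff_ne_zero.2 fun h => ?_
    have := gaussianReal_absolutelyContinuous' 0 (one_ne_zero (α := ℝ≥0)) h
    simp at this
  · have hv' : 0 < √(v : ℝ) := Real.sqrt_pos.2 (by positivity)
    have h1 : gaussianReal 0 1 (Set.Ioi |K|) ≤ gaussianReal 0 v (Set.Ioi m) := by
      rw [gaussianReal_eq_map_std v, Measure.map_apply (by fun_prop) measurableSet_Ioi]
      refine measure_mono fun x hx => ?_
      have hm' : m ≤ |K| * √(v : ℝ) := by
        refine (le_abs_self m).trans (abs_le_of_sq_le_sq' ?_ (by positivity)).2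
        rw [sq_abs, mul_pow, sq_abs, Real.sq_sqrt v.coe_nonneg]; exact hm
      have : |K| * √(v : ℝ) < x * √(v : ℝ) := mul_lt_mul_of_pos_right hx hv'
      simp only [Set.mem_preimage, Set.mem_Ioi]
      linarith
    refine ⟨h1, h1.trans_eq ?_⟩
    have h := gaussianReal_map_neg (μ := 0) (v := v)
    rw [neg_zero] at h
    conv_lhs => rw [← h]
    rw [Measure.map_apply measurable_neg measurableSet_Ioi]
    congr 1; ext x; simp

/-! ### Circular complex Gaussian variables -/

instance isProbabilityMeasure_complexGaussian (v : ℝ) :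
    IsProbabilityMeasure (complexGaussian v) :=
  Measure.isProbabilityMeasure_map (by fun_prop)

lemma lintegral_complexGaussian {lam : ℝ} (hlam : 0 < lam) {f : ℂ → ℝ≥0∞} (hf : Measurable f) :
    ∫⁻ z, f z ∂complexGaussian (1 / lam) =
      ∫⁻ z, ENNReal.ofReal (lam / Real.pi * Real.exp (-(lam * ‖z‖ ^ 2))) * f z := by
  have hv : (1 / lam / 2).toNNReal ≠ 0 := by
    rw [Ne, Real.toNNReal_eq_zero, not_le]; positivity
  rw [complexGaussian, lintegral_map_equiv, gaussianReal_of_var_ne_zero 0 hv,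
    prod_withDensity (measurable_gaussianPDF _ _) (measurable_gaussianPDF _ _),
    lintegral_withDensity_eq_lintegral_mul _ (by fun_prop) (by fun_prop),
    ← (Complex.volume_preserving_equiv_real_prod.symm).lintegral_comp_emb
      Complex.measurableEquivRealProd.symm.measurableEmbedding]
  refine lintegral_congr fun p => ?_
  simp only [Pi.mul_apply]
  congr 1
  rw [gaussianPDF, gaussianPDF, ← ENNReal.ofReal_mul (gaussianPDFReal_nonneg _ _ _)]
  congr 1
  have hn : ‖Complex.measurableEquivRealProd.symm p‖ ^ 2 = p.1 ^ 2 + p.2 ^ 2 := by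
    rw [Complex.sq_norm, Complex.normSq_apply]
    simp [Complex.measurableEquivRealProd, pow_two]
  have hc : ((1 / lam / 2).toNNReal : ℝ) = 1 / (2 * lam) := by
    rw [Real.coe_toNNReal _ (by positivity)]; field_simp
  rw [hn, gaussianPDFReal, gaussianPDFReal, hc, mul_mul_mul_comm, ← Real.exp_add, ← mul_inv,
    Real.mul_self_sqrt (by positivity)]
  congr 1
  · field_simp
  · congr 1; field_simp; ring

/-- The squared modulus of a circular complex Gaussian variable is exponential. -/
lemma lintegral_norm_sq_complexGaussian {lam : ℝ} (hlam : 0 < lam) {f : ℝ → ℝ≥0∞}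
    (hf : Measurable f) :
    ∫⁻ z, f (‖z‖ ^ 2) ∂complexGaussian (1 / lam) =
      ∫⁻ t in Set.Ioi 0, ENNReal.ofReal (lam * Real.exp (-(lam * t))) * f t := by
  rw [lintegral_complexGaussian hlam (by fun_prop), ← Complex.lintegral_comp_polarCoord_symm]
  simp only [Complex.norm_polarCoord_symm, sq_abs, smul_eq_mul]
  set g : ℝ → ℝ≥0∞ := fun r => ENNReal.ofReal r *
    (ENNReal.ofReal (lam / Real.pi * Real.exp (-(lam * r ^ 2))) * f (r ^ 2)) with hg
  have hgm : Measurable g := by fun_prop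
  have hprod : ∫⁻ p in polarCoord.target, g p.1 =
      ∫⁻ r in Set.Ioi 0, g r * ENNReal.ofReal (2 * Real.pi) := by
    rw [polarCoord_target, Measure.volume_eq_prod, ← Measure.prod_restrict,
      lintegral_prod _ (by fun_prop : Measurable fun p : ℝ × ℝ => g p.1).aemeasurable]
    refine lintegral_congr fun r => ?_
    dsimp only
    rw [lintegral_const, Measure.restrict_apply MeasurableSet.univ, Set.univ_inter,
      Real.volume_Ioo]
    congr 2; ring
  refine hprod.trans ?_
  have himg : (fun r : ℝ => r ^ 2) '' Set.Ioi 0 = Set.Ioi 0 := by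
    ext t; constructor
    · rintro ⟨r, hr, rfl⟩; exact pow_pos (Set.mem_Ioi.1 hr) 2
    · intro ht; exact ⟨√t, Real.sqrt_pos.2 ht, Real.sq_sqrt (le_of_lt ht)⟩
  conv_rhs => rw [← himg]
  rw [lintegral_image_eq_lintegral_abs_deriv_mul (f' := fun r => 2 * r) measurableSet_Ioi
    (fun r _ => ((hasDerivAt_pow 2 r).congr_deriv (by norm_num)).hasDerivWithinAt)
    (fun a ha b hb hab => (sq_eq_sq₀ (le_of_lt ha) (le_of_lt hb)).1 hab)]
  refine setLIntegral_congr_fun measurableSet_Ioi fun r hr => ?_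
  have hr : 0 < r := hr
  simp only [hg]
  rw [abs_of_pos (by positivity : 0 < 2 * r), mul_right_comm, ← mul_assoc, ← mul_assoc,
    ← ENNReal.ofReal_mul (by positivity), mul_right_comm, ← ENNReal.ofReal_mul (by positivity),
    mul_right_comm, ← ENNReal.ofReal_mul (by positivity)]
  congr 2
  field_simp

lemma lintegral_Ioi_exp {a : ℝ} (ha : 0 < a) (c : ℝ) :
    ∫⁻ t in Set.Ioi c, ENNReal.ofReal (Real.exp (-(a * t))) =
      ENNReal.ofReal (Real.exp (-(a * c)) / a) := by
  have h := integral_exp_mul_Ioi (a := -a) (by linarith) c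
  have hi := integrableOn_exp_mul_Ioi (a := -a) (by linarith) c
  simp only [neg_mul] at h hi
  rw [← ofReal_integral_eq_lintegral_ofReal hi (ae_of_all _ fun t => (Real.exp_pos _).le), h]
  congr 1
  rw [neg_div_neg_eq]

lemma lintegral_indicator_exp_norm_sq {lam t : ℝ} (hlam : 0 < lam) (ht : 0 ≤ t) {y : ℝ}
    (hy : 0 ≤ y) :
    ∫⁻ z, Set.indicator (Set.Ioi y) (fun x => ENNReal.ofReal (Real.exp (-(t * x)))) (‖z‖ ^ 2)
      ∂complexGaussian (1 / lam) =
      ENNReal.ofReal (lam / (t + lam) * Real.exp (-((t + lam) * y))) := by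
  rw [lintegral_norm_sq_complexGaussian hlam
    (f := Set.indicator (Set.Ioi y) fun x => ENNReal.ofReal (Real.exp (-(t * x))))
    (Measurable.indicator (by fun_prop) measurableSet_Ioi)]
  have : ∀ x, ENNReal.ofReal (lam * Real.exp (-(lam * x))) * Set.indicator (Set.Ioi y)
      (fun x => ENNReal.ofReal (Real.exp (-(t * x)))) x =
      Set.indicator (Set.Ioi y) (fun x => ENNReal.ofReal lam *
        ENNReal.ofReal (Real.exp (-((t + lam) * x)))) x := by
    intro x
    by_cases hx : x ∈ Set.Ioi y
    · simp only [Set.indicator_of_mem hx]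
      rw [← ENNReal.ofReal_mul (by positivity), ← ENNReal.ofReal_mul (by positivity), mul_assoc,
        ← Real.exp_add]
      congr 3; ring
    · simp [Set.indicator_of_notMem hx]
  simp_rw [this]
  rw [lintegral_indicator measurableSet_Ioi, Measure.restrict_restrict measurableSet_Ioi,
    Set.inter_eq_left.2 (Set.Ioi_subset_Ioi hy), lintegral_const_mul _ (by fun_prop),
    lintegral_Ioi_exp (by linarith), ← ENNReal.ofReal_mul hlam.le]
  congr 1; ring

lemma complexGaussian_norm_sq_Ioi {lam : ℝ} (hlam : 0 < lam) {y : ℝ} (hy : 0 ≤ y) :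
    complexGaussian (1 / lam) {z | y < ‖z‖ ^ 2} = ENNReal.ofReal (Real.exp (-(lam * y))) := by
  have h := lintegral_indicator_exp_norm_sq hlam le_rfl hy
  have hm : MeasurableSet {z : ℂ | y < ‖z‖ ^ 2} := measurableSet_lt (by fun_prop) (by fun_prop)
  rw [zero_add, div_self hlam.ne', one_mul] at h
  rw [← h, ← lintegral_indicator_one hm]
  refine lintegral_congr fun z => ?_
  simp [Set.indicator]

lemma ae_norm_sq_pos {lam : ℝ} (hlam : 0 < lam) :
    ∀ᵐ z ∂complexGaussian (1 / lam), 0 < ‖z‖ ^ 2 := by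
  have hm : MeasurableSet {z : ℂ | 0 < ‖z‖ ^ 2} := measurableSet_lt (by fun_prop) (by fun_prop)
  rw [ae_iff, ← Set.compl_ofPred, prob_compl_eq_zero_iff hm,
    complexGaussian_norm_sq_Ioi hlam le_rfl]
  simp

/-- The moment generating function of the squared modulus. -/
lemma lintegral_exp_norm_sq {lam t : ℝ} (hlam : 0 < lam) (ht : 0 ≤ t) :
    ∫⁻ z, ENNReal.ofReal (Real.exp (-(t * ‖z‖ ^ 2))) ∂complexGaussian (1 / lam) =
      ENNReal.ofReal (lam / (t + lam)) := by
  have h := lintegral_indicator_exp_norm_sq hlam ht le_rfl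
  rw [mul_zero, neg_zero, Real.exp_zero, mul_one] at h
  rw [← h]
  refine lintegral_congr_ae ?_
  filter_upwards [ae_norm_sq_pos hlam] with z hz
  rw [Set.indicator_of_mem (Set.mem_Ioi.2 hz)]

/-- Deep fades: the squared modulus lies in `(0, x]` with a probability of the order of `x`. -/
lemma le_complexGaussian_norm_sq_Ioc {lam : ℝ} (hlam : 0 < lam) {x : ℝ} (hx : 0 ≤ x) :
    ENNReal.ofReal (lam * x / (1 + lam * x)) ≤
      complexGaussian (1 / lam) {z | 0 < ‖z‖ ^ 2 ∧ ‖z‖ ^ 2 ≤ x} := by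
  have hm (y : ℝ) : MeasurableSet {z : ℂ | y < ‖z‖ ^ 2} :=
    measurableSet_lt (by fun_prop) (by fun_prop)
  have he : {z : ℂ | 0 < ‖z‖ ^ 2 ∧ ‖z‖ ^ 2 ≤ x} = {z | 0 < ‖z‖ ^ 2} \ {z | x < ‖z‖ ^ 2} := by
    ext z; simp
  have hsub : {z : ℂ | x < ‖z‖ ^ 2} ⊆ {z | 0 < ‖z‖ ^ 2} := fun z (hz : x < _) => hx.trans_lt hz
  rw [he, measure_sdiff hsub (hm x).nullMeasurableSet (measure_ne_top _ _),
    complexGaussian_norm_sq_Ioi hlam le_rfl, complexGaussian_norm_sq_Ioi hlam hx,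
    ← ENNReal.ofReal_sub _ (Real.exp_pos _).le]
  refine ENNReal.ofReal_le_ofReal ?_
  have h1 : Real.exp (-(lam * x)) ≤ 1 / (1 + lam * x) := by
    rw [Real.exp_neg, ← one_div]
    exact one_div_le_one_div_of_le (by positivity) (by linarith [Real.add_one_le_exp (lam * x)])
  have h2 : lam * x / (1 + lam * x) = 1 - 1 / (1 + lam * x) := by field_simp; ring
  rw [h2]
  simp only [mul_zero, neg_zero, Real.exp_zero]
  linarith

/-- For independent `X`, `Y` with the law of the squared gains, the expectation of `e^{-tX}` on the
event `Y ≤ X`. -/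
lemma lintegral_indicator_le_exp_norm_sq {lam t : ℝ} (hlam : 0 < lam) (ht : 0 ≤ t) :
    ∫⁻ w, ∫⁻ z, Set.indicator {z : ℂ | ‖w‖ ^ 2 ≤ ‖z‖ ^ 2}
      (fun z => ENNReal.ofReal (Real.exp (-(t * ‖z‖ ^ 2)))) z
      ∂complexGaussian (1 / lam) ∂complexGaussian (1 / lam) =
      ENNReal.ofReal (lam / (t + lam) * (lam / (t + 2 * lam))) := by
  have hae (y : ℝ) (hy : 0 ≤ y) : ∀ᵐ z ∂complexGaussian (1 / lam), ‖z‖ ^ 2 ≠ y := by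
    have h := lintegral_norm_sq_complexGaussian hlam (f := Set.indicator {y} 1)
      (measurable_one.indicator (measurableSet_singleton y))
    have h0 : ∫⁻ t in Set.Ioi 0, ENNReal.ofReal (lam * Real.exp (-(lam * t))) *
        Set.indicator {y} 1 t = 0 := by
      rw [← nonpos_iff_eq_zero]
      refine (setLIntegral_le_lintegral _ _).trans ?_
      refine (lintegral_eq_zero_of_ae_eq_zero ?_).le
      filter_upwards [measure_eq_zero_iff_ae_notMem.1 (measure_singleton (μ := volume) y)]
        with s hs
      simp only [Set.indicator_of_notMem hs, mul_zero, Pi.zero_apply]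
    have hmeas : Measurable fun z : ℂ => Set.indicator {y} (1 : ℝ → ℝ≥0∞) (‖z‖ ^ 2) :=
      (measurable_one.indicator (measurableSet_singleton y)).comp (by fun_prop)
    rw [h0, lintegral_eq_zero_iff hmeas] at h
    filter_upwards [h] with z hz hzy
    simp [hzy] at hz
  have inner (w : ℂ) : ∫⁻ z, Set.indicator {z : ℂ | ‖w‖ ^ 2 ≤ ‖z‖ ^ 2}
      (fun z => ENNReal.ofReal (Real.exp (-(t * ‖z‖ ^ 2)))) z ∂complexGaussian (1 / lam) =
      ENNReal.ofReal (lam / (t + lam)) *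
        ENNReal.ofReal (Real.exp (-((t + lam) * ‖w‖ ^ 2))) := by
    rw [← ENNReal.ofReal_mul (by positivity),
      ← lintegral_indicator_exp_norm_sq hlam ht (sq_nonneg ‖w‖)]
    refine lintegral_congr_ae ?_
    filter_upwards [hae (‖w‖ ^ 2) (sq_nonneg _)] with z hz
    have : ‖w‖ ^ 2 ≤ ‖z‖ ^ 2 ↔ ‖w‖ ^ 2 < ‖z‖ ^ 2 := ⟨fun h => lt_of_le_of_ne h hz.symm, le_of_lt⟩
    simp only [Set.indicator, Set.mem_ofPred_eq, Set.mem_Ioi, this]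
  simp_rw [inner]
  rw [lintegral_const_mul _ (by fun_prop), lintegral_exp_norm_sq hlam (by linarith),
    ← ENNReal.ofReal_mul (by positivity)]
  congr 3; ring

/-! ### Linear combinations of the noises -/

lemma map_prod_add_gaussian {α β : Type*} [MeasurableSpace α] [MeasurableSpace β] {μ : Measure α}
    {ν : Measure β} [SFinite μ] [SFinite ν] {f : α → ℝ} {g : β → ℝ} (hf : Measurable f)
    (hg : Measurable g) {v w : ℝ≥0} (hμ : μ.map f = gaussianReal 0 v)
    (hν : ν.map g = gaussianReal 0 w) :
    (μ.prod ν).map (fun p => f p.1 + g p.2) = gaussianReal 0 (v + w) := by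
  have h := gaussianReal_conv_gaussianReal (m₁ := 0) (m₂ := 0) (v₁ := v) (v₂ := w)
  rw [add_zero] at h
  rw [← h, ← hμ, ← hν, Measure.conv, Measure.map_prod_map _ _ hf hg,
    Measure.map_map (by fun_prop) (by fun_prop)]
  rfl

lemma complexGaussian_map_re_mul {N : ℝ} (hN : 0 ≤ N) (a : ℂ) :
    (complexGaussian N).map (fun z => (a * z).re) =
      gaussianReal 0 (‖a‖ ^ 2 * (N / 2)).toNNReal := by
  rw [complexGaussian, Measure.map_map (by fun_prop) (by fun_prop)]
  have h1 := gaussianReal_map_const_mul (μ := 0) (v := (N / 2).toNNReal) a.re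
  have h2 := gaussianReal_map_const_mul (μ := 0) (v := (N / 2).toNNReal) (-a.im)
  rw [mul_zero] at h1 h2
  have := map_prod_add_gaussian (by fun_prop) (by fun_prop) h1 h2
  convert this using 2
  · ext p
    simp [Complex.measurableEquivRealProd]
    ring
  · ext
    simp only [NNReal.coe_add, NNReal.coe_mul, NNReal.coe_mk]
    rw [Real.coe_toNNReal _ (by positivity), Real.coe_toNNReal _ (by positivity),
      Complex.sq_norm, Complex.normSq_apply]
    ring

/-- The joint law of the noises during one block, in the slot of each user and of the relay. -/
noncomputable def noiseLaw (ι : Type) [Fintype ι] (N : ℝ) : Measure ((User → ι → ℂ) × (ι → ℂ)) :=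
  (Measure.pi fun _ : User => Measure.pi fun _ : ι => complexGaussian N).prod
    (Measure.pi fun _ : ι => complexGaussian N)

instance (ι : Type) [Fintype ι] (N : ℝ) : IsProbabilityMeasure (noiseLaw ι N) := by
  unfold noiseLaw; infer_instance

lemma User.univ_eq (u : User) : (Finset.univ : Finset User) = {u, u.other} := by
  cases u <;> decide

lemma User.other_ne (u : User) : u.other ≠ u := by cases u <;> decide

@[simp]
lemma User.other_other (u : User) : u.other.other = u := by cases u <;> rfl

lemma measurePreserving_eval_user_pair {X : Type*} [MeasurableSpace X] (μ : Measure X)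
    [SigmaFinite μ] (u : User) :
    MeasurePreserving (fun f : User → X => (f u, f u.other)) (Measure.pi fun _ => μ)
      (μ.prod μ) := by
  refine ⟨by fun_prop, (Measure.prod_eq fun s t hs ht => ?_).symm⟩
  rw [Measure.map_apply (by fun_prop) (hs.prod ht)]
  have : (fun f : User → X => (f u, f u.other)) ⁻¹' s ×ˢ t =
      Set.univ.pi fun w => if w = u then s else t := by
    ext f
    simp only [Set.mem_preimage, Set.mem_prod, Set.mem_pi, Set.mem_univ, true_imp_iff]
    constructor
    · rintro ⟨h1, h2⟩ w
      have hw : w ∈ ({u, u.other} : Finset User) := User.univ_eq u ▸ Finset.mem_univ w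
      rcases Finset.mem_insert.1 hw with rfl | hw
      · simpa using h1
      · rw [Finset.mem_singleton.1 hw]; simpa [u.other_ne] using h2
    · intro h
      exact ⟨by simpa using h u, by simpa [u.other_ne] using h u.other⟩
  rw [this, Measure.pi_pi, User.univ_eq u, Finset.prod_pair u.other_ne.symm]
  simp [u.other_ne]

/-- A fixed real-linear combination of the noises at each symbol: these are independent Gaussian
variables. -/
lemma noiseLaw_map_re {ι : Type} [Fintype ι] {N : ℝ} (hN : 0 ≤ N) (u : User) (a b c : ℂ) :
    (noiseLaw ι N).map (fun n i => (a * n.1 u i + b * n.1 u.other i + c * n.2 i).re) =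
      Measure.pi fun _ : ι =>
        gaussianReal 0 ((‖a‖ ^ 2 + ‖b‖ ^ 2 + ‖c‖ ^ 2) * (N / 2)).toNNReal := by
  set g := complexGaussian N
  have m1 : MeasurePreserving
      (Prod.map (fun f : User → ι → ℂ => (f u, f u.other)) (id : (ι → ℂ) → ι → ℂ))
      (noiseLaw ι N) (((Measure.pi fun _ => g).prod (Measure.pi fun _ => g)).prod
        (Measure.pi fun _ => g)) :=
    (measurePreserving_eval_user_pair _ u).prod (MeasurePreserving.id _)
  have m2 : MeasurePreserving
      (Prod.map (MeasurableEquiv.arrowProdEquivProdArrow ℂ ℂ ι).symm (id : (ι → ℂ) → ι → ℂ))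
      (((Measure.pi fun _ => g).prod (Measure.pi fun _ => g)).prod (Measure.pi fun _ => g))
      ((Measure.pi fun _ => g.prod g).prod (Measure.pi fun _ => g)) :=
    ((measurePreserving_arrowProdEquivProdArrow ℂ ℂ ι (fun _ => g) fun _ => g).symm).prod
      (MeasurePreserving.id _)
  have m3 := (measurePreserving_arrowProdEquivProdArrow (ℂ × ℂ) ℂ ι (fun _ => g.prod g)
    fun _ => g).symm
  have m := m3.comp (m2.comp m1)
  have hl : ((g.prod g).prod g).map (fun p => (a * p.1.1).re + (b * p.1.2).re + (c * p.2).re) =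
      gaussianReal 0 ((‖a‖ ^ 2 + ‖b‖ ^ 2 + ‖c‖ ^ 2) * (N / 2)).toNNReal := by
    have := map_prod_add_gaussian (f := fun p : ℂ × ℂ => (a * p.1).re + (b * p.2).re)
      (g := fun z => (c * z).re) (by fun_prop) (by fun_prop)
      (map_prod_add_gaussian (by fun_prop) (by fun_prop) (complexGaussian_map_re_mul hN a)
        (complexGaussian_map_re_mul hN b)) (complexGaussian_map_re_mul hN c)
    rw [this, add_mul, add_mul, Real.toNNReal_add (by positivity) (by positivity),
      Real.toNNReal_add (by positivity) (by positivity)]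
  rw [← hl]
  have := Measure.pi_map_pi (μ := fun _ : ι => (g.prod g).prod g)
    (f := fun _ p => (a * p.1.1).re + (b * p.1.2).re + (c * p.2).re)
    (fun i => (by fun_prop : Measurable _).aemeasurable)
  rw [← this, ← m.map_eq, Measure.map_map (by fun_prop) m.measurable]
  rfl

/-! ### Hard decisions in Gaussian noise -/

/-- The hard decisions on the code bits `e`, sent with BPSK of symbol energy `E`, when the real
parts of the decision variables have signal gain `G` and noise `w`. -/
noncomputable def hardBits {ι : Type} (G E : ℝ) (e : ι → ZMod 2) (w : ι → ℝ) (i : ι) : ZMod 2 :=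
  open Classical in if 0 ≤ G * (bpsk E (e i)).re + w i then 0 else 1

/-- The law of the noise in the decision variables of a block after a combination with signal gain
`G`: independent Gaussian variables of variance `G * N / 2`. -/
noncomputable def combinedNoise (ι : Type) [Fintype ι] (G N : ℝ) : Measure (ι → ℝ) :=
  Measure.pi fun _ => gaussianReal 0 (G * (N / 2)).toNNReal

instance (ι : Type) [Fintype ι] (G N : ℝ) : IsProbabilityMeasure (combinedNoise ι G N) := by
  unfold combinedNoise; infer_instance

lemma bpsk_re (E : ℝ) (b : ZMod 2) : (bpsk E b).re = if b = 0 then √E else -√E := by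
  unfold bpsk; split_ifs <;> simp

lemma measurable_hardBits {ι X : Type} [MeasurableSpace X] {G : X → ℝ} {W : X → ι → ℝ}
    (hG : Measurable G) (hW : Measurable W) (E : ℝ) (e : ι → ZMod 2) :
    Measurable fun x => hardBits (G x) E e (W x) := by
  refine measurable_pi_lambda _ fun i => ?_
  have : Measurable fun x => G x * (bpsk E (e i)).re + W x i := by fun_prop
  exact Measurable.ite (measurableSet_le measurable_const this) measurable_const measurable_const

lemma zmod_two_eq_one {b : ZMod 2} (h : b ≠ 0) : b = 1 := by
  revert b; decide

section Flips

variable {ι : Type} {G E N : ℝ}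

lemma toNNReal_variance_ne_zero (hG : 0 < G) (hN : 0 < N) : (G * (N / 2)).toNNReal ≠ 0 := by
  rw [Ne, Real.toNNReal_eq_zero, not_le]; positivity

/-- The error probability of one hard decision. -/
lemma gaussianReal_flip_le (hG : 0 < G) (hE : 0 ≤ E) (hN : 0 < N) (e : ZMod 2) :
    gaussianReal 0 (G * (N / 2)).toNNReal
      {w | (open Classical in if 0 ≤ G * (bpsk E e).re + w then (0 : ZMod 2) else 1) ≠ e} ≤
      ENNReal.ofReal (1 / 4 * Real.exp (-(E / N * G)) + 1 / 4 * Real.exp (-(2 * (E / N) * G))) := by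
  have hv := toNNReal_variance_ne_zero hG hN
  have key := gaussianReal_Ici_le hv (m := G * √E) (by positivity)
  have hc : ((G * (N / 2)).toNNReal : ℝ) = G * (N / 2) := Real.coe_toNNReal _ (by positivity)
  have e1 : (G * √E) ^ 2 / (2 * (G * (N / 2))) = E / N * G := by
    rw [mul_pow, Real.sq_sqrt hE]; field_simp
  have e2 : (G * √E) ^ 2 / (G * (N / 2)) = 2 * (E / N) * G := by
    rw [mul_pow, Real.sq_sqrt hE]; field_simp
  rw [hc, e1, e2] at key
  by_cases he : e = 0
  · refine le_trans (measure_mono fun w hw => ?_) ((gaussianReal_Iic_neg _ _).trans_le key)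
    simp only [bpsk_re, he, if_true, Set.mem_ofPred_eq, ne_eq, ite_eq_left_iff, one_ne_zero,
      imp_false, not_not, not_le] at hw
    simp only [Set.mem_Iic]
    linarith
  · refine le_trans (measure_mono fun w hw => ?_) key
    have h1 := zmod_two_eq_one he
    subst h1
    simp only [bpsk_re, one_ne_zero, if_false, Set.mem_ofPred_eq, ne_eq, ite_eq_right_iff,
      zero_ne_one, imp_false, not_not] at hw
    simp only [Set.mem_Ici]
    linarith

lemma combinedNoise_pi [Fintype ι] (A : ι → Set ℝ) :
    combinedNoise ι G N {w | ∀ i, w i ∈ A i} =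
      ∏ i, gaussianReal 0 (G * (N / 2)).toNNReal (A i) := by
  rw [← Measure.pi_pi, combinedNoise]
  congr 1; ext w; simp

/-- The probability that all hard decisions on a set of symbols are wrong. -/
lemma combinedNoise_flips_le [Fintype ι] (hG : 0 < G) (hE : 0 ≤ E) (hN : 0 < N) (e : ι → ZMod 2)
    (S : Finset ι) :
    combinedNoise ι G N {w | ∀ i ∈ S, hardBits G E e w i ≠ e i} ≤
      ENNReal.ofReal (1 / 4 * Real.exp (-(E / N * G)) +
        1 / 4 * Real.exp (-(2 * (E / N) * G))) ^ S.card := by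
  classical
  have h := combinedNoise_pi (ι := ι) (G := G) (N := N) fun i => if i ∈ S then
    {x | (open Classical in if 0 ≤ G * (bpsk E (e i)).re + x then (0 : ZMod 2) else 1) ≠ e i}
    else Set.univ
  have hs : {w : ι → ℝ | ∀ i ∈ S, hardBits G E e w i ≠ e i} =
      {w | ∀ i, w i ∈ if i ∈ S then {x | (open Classical in
        if 0 ≤ G * (bpsk E (e i)).re + x then (0 : ZMod 2) else 1) ≠ e i} else Set.univ} := by
    ext w
    simp only [Set.mem_ofPred_eq]
    refine forall_congr' fun i => ?_
    by_cases hi : i ∈ S <;> simp [hi, hardBits]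
  rw [hs, h, ← Finset.prod_subset (Finset.subset_univ S) fun i _ hi => by simp [hi]]
  refine Finset.prod_le_pow_card _ _ _ fun i hi => ?_
  rw [if_pos hi]
  exact gaussianReal_flip_le hG hE hN (e i)

/-- At bounded SNR every pattern of hard decisions has a probability bounded below. -/
lemma exists_le_combinedNoise_hardBits_eq (ι : Type) [Fintype ι] :
    ∃ q : ℝ≥0∞, 0 < q ∧ q ≤ 1 ∧ ∀ {G E N : ℝ}, 0 < G → 0 ≤ E → 0 < N → G * E ≤ N →
      ∀ e y : ι → ZMod 2, q ≤ combinedNoise ι G N {w | hardBits G E e w = y} := by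
  obtain ⟨q, hq0, hq1, hq⟩ := exists_le_gaussianReal_Ioi √2
  refine ⟨q ^ Fintype.card ι, ENNReal.pow_pos hq0 _, pow_le_one₀ zero_le hq1,
    fun {G E N} hG hE hN hGE e y => ?_⟩
  have hv := toNNReal_variance_ne_zero hG hN
  have hc : ((G * (N / 2)).toNNReal : ℝ) = G * (N / 2) := Real.coe_toNNReal _ (by positivity)
  obtain ⟨h1, h2⟩ := hq _ (G * √E) hv (by
    rw [hc, Real.sq_sqrt (by norm_num), mul_pow, Real.sq_sqrt hE]
    nlinarith [mul_le_mul_of_nonneg_left hGE hG.le])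
  have h := combinedNoise_pi (ι := ι) (G := G) (N := N) fun i =>
    {x | (open Classical in if 0 ≤ G * (bpsk E (e i)).re + x then (0 : ZMod 2) else 1) = y i}
  have hs : {w : ι → ℝ | hardBits G E e w = y} = {w | ∀ i, w i ∈ {x | (open Classical in
        if 0 ≤ G * (bpsk E (e i)).re + x then (0 : ZMod 2) else 1) = y i}} := by
    ext w; simp [funext_iff, hardBits]
  rw [hs, h, ← Finset.card_univ]
  refine Finset.pow_card_le_prod _ _ _ fun i _ => ?_
  have hx : |(bpsk E (e i)).re| ≤ √E := by
    rw [bpsk_re]; split_ifs <;> simp [abs_of_nonneg (Real.sqrt_nonneg E)]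
  obtain ⟨hx1, hx2⟩ := abs_le.1 hx
  have hx1' := mul_le_mul_of_nonneg_left hx1 hG.le
  have hx2' := mul_le_mul_of_nonneg_left hx2 hG.le
  by_cases hy : y i = 0
  · refine h1.trans (measure_mono fun w hw => ?_)
    simp only [Set.mem_Ioi] at hw
    simp only [Set.mem_ofPred_eq, hy]
    rw [if_pos (by linarith)]
  · refine h2.trans (measure_mono fun w hw => ?_)
    simp only [Set.mem_Iio] at hw
    simp only [Set.mem_ofPred_eq, zmod_two_eq_one hy]
    rw [if_neg (by linarith)]

end Flips

/-! ### Error probabilities at a given combined gain -/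

/-- The bound on the bit error probability of uncoded transmission at the combined gain `G`. -/
lemma combinedNoise_uncoded_le {κ : Type} [Fintype κ] {G E N : ℝ} (hG : 0 < G) (hE : 0 ≤ E)
    (hN : 0 < N) (e : κ → ZMod 2) (j : κ) :
    combinedNoise κ G N {w | hardBits G E e w j ≠ e j} ≤
      ENNReal.ofReal (1 / 4 * Real.exp (-(E / N * G)) + 1 / 4 * Real.exp (-(2 * (E / N) * G))) := by
  simpa using combinedNoise_flips_le hG hE hN e {j}

/-- If a Viterbi decoder for a code of minimum distance `d` fails, at least half of `d` hard
decisions are wrong. -/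
lemma IsViterbi.le_two_mul_card {κ ι : Type} [Fintype ι] {C : Codec κ ι} (hC : IsViterbi C)
    {d : ℕ} {b : κ → ZMod 2} (hd : ∀ b', b' ≠ b → d ≤ hammingDist (C.enc b') (C.enc b))
    {y : ι → ZMod 2} (h : C.dec y ≠ b) : d ≤ 2 * hammingDist y (C.enc b) := by
  calc d ≤ hammingDist (C.enc (C.dec y)) (C.enc b) := hd _ h
    _ ≤ hammingDist (C.enc (C.dec y)) y + hammingDist y (C.enc b) := hammingDist_triangle _ _ _
    _ ≤ hammingDist y (C.enc b) + hammingDist y (C.enc b) := by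
        rw [hammingDist_comm]; gcongr; exact hC y b
    _ = _ := by ring

/-- The bound on the block error probability of Viterbi decoding at the combined gain `G`. -/
lemma combinedNoise_viterbi_le {κ ι : Type} [Fintype ι] {C : Codec κ ι} (hC : IsViterbi C)
    {d : ℕ} {b : κ → ZMod 2} (hd : ∀ b', b' ≠ b → d ≤ hammingDist (C.enc b') (C.enc b))
    {G E N : ℝ} (hG : 0 < G) (hE : 0 ≤ E) (hN : 0 < N) :
    combinedNoise ι G N {w | C.dec (hardBits G E (C.enc b) w) ≠ b} ≤
      ENNReal.ofReal (2 ^ Fintype.card ι * Real.exp (-(E / N * (d / 2) * G))) := by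
  classical
  set P : Finset (Finset ι) := Finset.univ.filter fun S => d ≤ 2 * S.card with hP
  have hsub : {w | C.dec (hardBits G E (C.enc b) w) ≠ b} ⊆
      ⋃ S ∈ P, {w | ∀ i ∈ S, hardBits G E (C.enc b) w i ≠ C.enc b i} := by
    intro w hw
    simp only [Set.mem_iUnion]
    refine ⟨Finset.univ.filter fun i => hardBits G E (C.enc b) w i ≠ C.enc b i, ?_, ?_⟩
    · rw [hP, Finset.mem_filter]
      refine ⟨Finset.mem_univ _, (hC.le_two_mul_card hd hw).trans_eq ?_⟩
      rw [hammingDist]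
    · intro i hi; simpa using hi
  have hx : 0 ≤ E / N * G := by positivity
  have hbase : 1 / 4 * Real.exp (-(E / N * G)) + 1 / 4 * Real.exp (-(2 * (E / N) * G)) ≤
      Real.exp (-(E / N * G)) := by
    have : Real.exp (-(2 * (E / N) * G)) ≤ Real.exp (-(E / N * G)) :=
      Real.exp_le_exp.2 (by nlinarith)
    have := Real.exp_pos (-(E / N * G))
    linarith
  refine (measure_mono hsub).trans ((measure_biUnion_finset_le _ _).trans ?_)
  calc ∑ S ∈ P, combinedNoise ι G N {w | ∀ i ∈ S, hardBits G E (C.enc b) w i ≠ C.enc b i}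
      ≤ ∑ S ∈ P, ENNReal.ofReal (Real.exp (-(E / N * (d / 2) * G))) := by
        refine Finset.sum_le_sum fun S hS => (combinedNoise_flips_le hG hE hN _ S).trans ?_
        rw [← ENNReal.ofReal_pow (by positivity)]
        refine ENNReal.ofReal_le_ofReal ((pow_le_pow_left₀ (by positivity) hbase _).trans ?_)
        rw [← Real.exp_nat_mul]
        refine Real.exp_le_exp.2 ?_
        have h2 : (d : ℝ) ≤ 2 * S.card := by exact_mod_cast (Finset.mem_filter.1 hS).2
        nlinarith
    _ ≤ ∑ S : Finset ι, ENNReal.ofReal (Real.exp (-(E / N * (d / 2) * G))) :=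
        Finset.sum_le_sum_of_subset (Finset.subset_univ P)
    _ = _ := by
        rw [Finset.sum_const, Finset.card_univ, Fintype.card_finset, nsmul_eq_mul,
          ENNReal.ofReal_mul (by positivity)]
        congr 1
        rw [ENNReal.ofReal_pow (by norm_num)]
        simp

/-! ### Separation of the bits, the destination and the relay -/

/-- The gains and noises that the destination sees. -/
abbrev DestSample (ι : Type) : Type := ((User → ℂ) × ℂ) × ((User → ι → ℂ) × (ι → ℂ))

/-- The gains and noises that the relay sees. -/
abbrev RelaySample (ι : Type) : Type := (User → ℂ) × (User → ι → ℂ)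

/-- The law of the gains towards the destination. -/
noncomputable def gainLaw (lam : ℝ) : Measure ((User → ℂ) × ℂ) :=
  (Measure.pi fun _ : User => complexGaussian (1 / lam)).prod (complexGaussian (1 / lam))

instance (lam : ℝ) : IsProbabilityMeasure (gainLaw lam) := by
  unfold gainLaw; infer_instance

/-- The law of what the destination sees. -/
noncomputable def destLaw (ι : Type) [Fintype ι] (lam N0 : ℝ) : Measure (DestSample ι) :=
  (gainLaw lam).prod (noiseLaw ι N0)

instance (ι : Type) [Fintype ι] (lam N0 : ℝ) : IsProbabilityMeasure (destLaw ι lam N0) := by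
  unfold destLaw; infer_instance

/-- The law of what the relay sees. -/
noncomputable def relayLaw (ι : Type) [Fintype ι] (lamR N0 : ℝ) : Measure (RelaySample ι) :=
  (Measure.pi fun _ : User => complexGaussian (1 / lamR)).prod
    (Measure.pi fun _ : User => Measure.pi fun _ : ι => complexGaussian N0)

instance (ι : Type) [Fintype ι] (lamR N0 : ℝ) : IsProbabilityMeasure (relayLaw ι lamR N0) := by
  unfold relayLaw; infer_instance

/-- The uniform law of the information bits. -/
noncomputable def bitLaw (κ : Type) [Fintype κ] : Measure (User → κ → ZMod 2) :=
  uniformOn Set.univ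

instance (κ : Type) [Fintype κ] : IsProbabilityMeasure (bitLaw κ) :=
  isProbabilityMeasure_uniformOn Set.finite_univ Set.univ_nonempty

namespace Sample

variable {κ ι : Type}

/-- The part of the realization that the destination sees. -/
def dest (ω : Sample κ ι) : DestSample ι := ((ω.hUD, ω.hRD), (ω.nUD, ω.nRD))

/-- The part of the realization that the relay sees. -/
def relay (ω : Sample κ ι) : RelaySample ι := (ω.hUR, ω.nUR)

end Sample

section Separation

variable {κ ι : Type} [Fintype κ] [Fintype ι]

lemma measurePreserving_prod_left_comm {α β γ : Type*} [MeasurableSpace α] [MeasurableSpace β]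
    [MeasurableSpace γ] (μ : Measure α) (ν : Measure β) (τ : Measure γ) [SFinite μ] [SFinite ν]
    [SFinite τ] :
    MeasurePreserving (fun p : α × β × γ => (p.2.1, (p.1, p.2.2))) (μ.prod (ν.prod τ))
      (ν.prod (μ.prod τ)) := by
  have h1 := (measurePreserving_prodAssoc μ ν τ).symm
  have h2 : MeasurePreserving (Prod.map Prod.swap id) ((μ.prod ν).prod τ) ((ν.prod μ).prod τ) :=
    Measure.measurePreserving_swap.prod (MeasurePreserving.id τ)
  exact (measurePreserving_prodAssoc ν μ τ).comp (h2.comp h1)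

/-- What the destination sees and what the relay sees are independent of each other and of the
bits. -/
lemma measurePreserving_separate (lam lamR N0 : ℝ) :
    MeasurePreserving (fun ω : Sample κ ι => (ω.bits, (ω.dest, ω.relay)))
      (law κ ι lam lamR N0)
      ((bitLaw κ).prod ((destLaw ι lam N0).prod (relayLaw ι lamR N0))) := by
  set b := Measure.pi fun _ : User => complexGaussian (1 / lam)
  set c := complexGaussian (1 / lam)
  set d := Measure.pi fun _ : User => complexGaussian (1 / lamR)
  set e := Measure.pi fun _ : User => Measure.pi fun _ : ι => complexGaussian N0
  set f := Measure.pi fun _ : ι => complexGaussian N0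
  have h1 : MeasurePreserving (fun p : (User → ℂ) × (User → ι → ℂ) × (ι → ℂ) × (User → ι → ℂ) =>
      ((p.2.1, p.2.2.1), (p.1, p.2.2.2))) (d.prod (e.prod (f.prod e)))
      ((e.prod f).prod (d.prod e)) :=
    (measurePreserving_prod_left_comm d (e.prod f) e).comp
      ((MeasurePreserving.id d).prod (measurePreserving_prodAssoc e f e).symm)
  have h2 : MeasurePreserving (fun p : (User → ℂ) × ℂ × ((User → ι → ℂ) × (ι → ℂ)) ×
      ((User → ℂ) × (User → ι → ℂ)) => (((p.1, p.2.1), p.2.2.1), p.2.2.2))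
      (b.prod (c.prod ((e.prod f).prod (d.prod e)))) (((b.prod c).prod (e.prod f)).prod
        (d.prod e)) :=
    (measurePreserving_prodAssoc (b.prod c) (e.prod f) (d.prod e)).symm.comp
      (measurePreserving_prodAssoc b c ((e.prod f).prod (d.prod e))).symm
  exact (MeasurePreserving.id (bitLaw κ)).prod
    (h2.comp ((MeasurePreserving.id b).prod ((MeasurePreserving.id c).prod h1)))

lemma measurableSet_prod_of_forall {α β : Type*} [MeasurableSpace α] [Countable α]
    [MeasurableSingletonClass α] [MeasurableSpace β] {A : α → Set β}
    (hA : ∀ a, MeasurableSet (A a)) : MeasurableSet {p : α × β | p.2 ∈ A p.1} := by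
  have : {p : α × β | p.2 ∈ A p.1} = ⋃ a, {a} ×ˢ A a := by
    ext ⟨a, b⟩; simp
  rw [this]
  exact MeasurableSet.iUnion fun a => (measurableSet_singleton a).prod (hA a)

/-- Given the bits, the events at the destination and at the relay are independent. -/
lemma law_separate (lam lamR N0 : ℝ) {D : (User → κ → ZMod 2) → Set (DestSample ι)}
    {A : (User → κ → ZMod 2) → Set (RelaySample ι)} (hD : ∀ b, MeasurableSet (D b))
    (hA : ∀ b, MeasurableSet (A b)) :
    law κ ι lam lamR N0 {ω | ω.dest ∈ D ω.bits ∧ ω.relay ∈ A ω.bits} =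
      ∫⁻ b, destLaw ι lam N0 (D b) * relayLaw ι lamR N0 (A b) ∂bitLaw κ := by
  have hm : MeasurableSet {p : (User → κ → ZMod 2) × DestSample ι × RelaySample ι |
      p.2 ∈ D p.1 ×ˢ A p.1} := measurableSet_prod_of_forall fun b => (hD b).prod (hA b)
  have h := (measurePreserving_separate (κ := κ) (ι := ι) lam lamR N0).measure_preimage
    hm.nullMeasurableSet
  rw [Measure.prod_apply hm] at h
  refine h.trans (lintegral_congr fun b => ?_)
  rw [← Measure.prod_prod]
  rfl

lemma law_relay (lam lamR N0 : ℝ) {A : (User → κ → ZMod 2) → Set (RelaySample ι)}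
    (hA : ∀ b, MeasurableSet (A b)) :
    law κ ι lam lamR N0 {ω | ω.relay ∈ A ω.bits} = ∫⁻ b, relayLaw ι lamR N0 (A b) ∂bitLaw κ := by
  simpa using law_separate lam lamR N0 (D := fun _ => Set.univ) (fun _ => MeasurableSet.univ) hA

lemma law_separate_le (lam lamR N0 : ℝ) {D : (User → κ → ZMod 2) → Set (DestSample ι)}
    {A : (User → κ → ZMod 2) → Set (RelaySample ι)} (hD : ∀ b, MeasurableSet (D b))
    (hA : ∀ b, MeasurableSet (A b)) {c : ℝ≥0∞} (hc : ∀ b, destLaw ι lam N0 (D b) ≤ c) :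
    law κ ι lam lamR N0 {ω | ω.dest ∈ D ω.bits ∧ ω.relay ∈ A ω.bits} ≤
      c * law κ ι lam lamR N0 {ω | ω.relay ∈ A ω.bits} := by
  rw [law_separate lam lamR N0 hD hA, law_relay lam lamR N0 hA,
    ← lintegral_const_mul _ (measurable_of_finite _)]
  exact lintegral_mono fun b => by gcongr; exact hc b

lemma le_law_separate (lam lamR N0 : ℝ) {D : (User → κ → ZMod 2) → Set (DestSample ι)}
    {A : (User → κ → ZMod 2) → Set (RelaySample ι)} (hD : ∀ b, MeasurableSet (D b))
    (hA : ∀ b, MeasurableSet (A b)) {c c' : ℝ≥0∞} (hc : ∀ b, c ≤ destLaw ι lam N0 (D b))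
    (hc' : ∀ b, c' ≤ relayLaw ι lamR N0 (A b)) :
    c * c' ≤ law κ ι lam lamR N0 {ω | ω.dest ∈ D ω.bits ∧ ω.relay ∈ A ω.bits} := by
  rw [law_separate lam lamR N0 hD hA]
  calc c * c' = ∫⁻ _, c * c' ∂bitLaw κ := by simp
    _ ≤ _ := lintegral_mono fun b => mul_le_mul' (hc b) (hc' b)

/-- Averaging over the gains: the combined noise has the law `combinedNoise` given the gains. -/
lemma prod_hardBits {X Y : Type} [MeasurableSpace X] [MeasurableSpace Y] {μ : Measure X}
    {ν : Measure Y} [SFinite μ] [SFinite ν] {W : X → Y → ι → ℝ} {G : X → ℝ} {N : ℝ} (E : ℝ)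
    (hW : Measurable fun p : X × Y => W p.1 p.2) (hG : Measurable G)
    (hlaw : ∀ x, ν.map (W x) = combinedNoise ι (G x) N) {H : Set X} (hH : MeasurableSet H)
    (e : ι → ZMod 2) (F : Set (ι → ZMod 2)) :
    MeasurableSet {p : X × Y | p.1 ∈ H ∧ hardBits (G p.1) E e (W p.1 p.2) ∈ F} ∧
    μ.prod ν {p | p.1 ∈ H ∧ hardBits (G p.1) E e (W p.1 p.2) ∈ F} =
      ∫⁻ x in H, combinedNoise ι (G x) N {w | hardBits (G x) E e w ∈ F} ∂μ := by
  have hm : MeasurableSet {p : X × Y | p.1 ∈ H ∧ hardBits (G p.1) E e (W p.1 p.2) ∈ F} :=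
    (hH.preimage measurable_fst).inter
      ((measurable_hardBits (hG.comp measurable_fst) hW E e) (Set.toFinite F).measurableSet)
  refine ⟨hm, ?_⟩
  rw [Measure.prod_apply hm, ← lintegral_indicator hH]
  refine lintegral_congr fun x => ?_
  by_cases hx : x ∈ H
  · have hWx : Measurable (W x) := hW.comp measurable_prodMk_left
    have hF : MeasurableSet {w | hardBits (G x) E e w ∈ F} :=
      (measurable_hardBits measurable_const measurable_id E e) (Set.toFinite F).measurableSet
    rw [Set.indicator_of_mem hx, ← hlaw, Measure.map_apply hWx hF]
    congr 1; ext y; simp [hx]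
  · rw [Set.indicator_of_notMem hx]
    simp [hx]

end Separation

/-! ### The decision variables -/

lemma hardBit_eq_hardBits {ι : Type} {G E : ℝ} {e : ι → ZMod 2} {w : ι → ℝ} {T : ι → ℂ}
    (h : ∀ i, (T i).re = G * (bpsk E (e i)).re + w i) :
    (fun i => hardBit (T i)) = hardBits G E e w := by
  ext1 i
  rw [hardBit, hardBits, h i]

/-- The real part of the combination of the noises at the destination with coefficients `f`: those
of the slots of user `u`, of the other user, and of the relay. -/
def combineNoise {ι : Type} (u : User) (f : ℂ × ℂ × ℂ) (n : (User → ι → ℂ) × (ι → ℂ)) (i : ι) : ℝ :=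
  (f.1 * n.1 u i + f.2.1 * n.1 u.other i + f.2.2 * n.2 i).re

/-- The squared norm of a combination, which equals its signal gain in all receivers below. -/
noncomputable def combinerGain (f : ℂ × ℂ × ℂ) : ℝ := ‖f.1‖ ^ 2 + ‖f.2.1‖ ^ 2 + ‖f.2.2‖ ^ 2

/-- Coefficients of the direct detection of user `u`, from the gains. -/
noncomputable def directCombiner (u : User) (γ : (User → ℂ) × ℂ) : ℂ × ℂ × ℂ :=
  (conj (γ.1 u), 0, 0)

/-- Coefficients of the maximum ratio combination of the direct and the relay signal. -/
noncomputable def mrcCombiner (u : User) (γ : (User → ℂ) × ℂ) : ℂ × ℂ × ℂ :=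
  (conj (γ.1 u), 0, conj γ.2)

/-- The norm of the channel vector of the user other than `u`. -/
noncomputable def interfererNorm (u : User) (γ : (User → ℂ) × ℂ) : ℝ :=
  √(‖γ.1 u.other‖ ^ 2 + ‖γ.2‖ ^ 2)

/-- Coefficients of nulling the other user, followed by maximum ratio combining. -/
noncomputable def nullCombiner (u : User) (γ : (User → ℂ) × ℂ) : ℂ × ℂ × ℂ :=
  (conj (γ.1 u), -(conj (γ.2 * γ.1 u.other / (interfererNorm u γ : ℂ)) * γ.2 /
    (interfererNorm u γ : ℂ)), conj (γ.2 * γ.1 u.other / (interfererNorm u γ : ℂ)) *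
      γ.1 u.other / (interfererNorm u γ : ℂ))

lemma combinerGain_direct (u : User) (γ : (User → ℂ) × ℂ) :
    combinerGain (directCombiner u γ) = ‖γ.1 u‖ ^ 2 := by
  simp [combinerGain, directCombiner]

lemma combinerGain_mrc (u : User) (γ : (User → ℂ) × ℂ) :
    combinerGain (mrcCombiner u γ) = ‖γ.1 u‖ ^ 2 + ‖γ.2‖ ^ 2 := by
  simp [combinerGain, mrcCombiner]

/-- Nulling projects on a unit vector, so it does not change the noise power. -/
lemma combinerGain_null (u : User) (γ : (User → ℂ) × ℂ) :
    combinerGain (nullCombiner u γ) =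
      ‖γ.1 u‖ ^ 2 + ‖γ.2 * γ.1 u.other / (interfererNorm u γ : ℂ)‖ ^ 2 := by
  have hD : interfererNorm u γ ^ 2 = ‖γ.1 u.other‖ ^ 2 + ‖γ.2‖ ^ 2 :=
    Real.sq_sqrt (by positivity)
  simp only [combinerGain, nullCombiner, norm_neg, norm_mul, norm_div, RCLike.norm_conj,
    Complex.norm_real, Real.norm_eq_abs, div_pow, mul_pow, sq_abs]
  rw [add_assoc]
  congr 1
  by_cases h0 : interfererNorm u γ = 0
  · simp [h0]
  · field_simp
    rw [hD]
    ring

lemma norm_sq_le_combinerGain {f : ℂ × ℂ × ℂ} {h : ℂ} (hf : f.1 = conj h) :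
    ‖h‖ ^ 2 ≤ combinerGain f := by
  rw [combinerGain, hf, RCLike.norm_conj]
  nlinarith [sq_nonneg ‖f.2.1‖, sq_nonneg ‖f.2.2‖]

lemma conj_mul_self_eq (z : ℂ) : conj z * z = ((‖z‖ ^ 2 : ℝ) : ℂ) := by
  rw [Complex.conj_mul']; norm_cast

lemma re_eq_of_eq_add {T S : ℂ} {G E : ℝ} {b : ZMod 2} (h : T = (G : ℂ) * bpsk E b + S) :
    T.re = G * (bpsk E b).re + S.re := by
  rw [h, Complex.add_re, Complex.re_ofReal_mul]

section Scheme

variable {κ ι : Type} (C : Codec κ ι) (E N0 : ℝ) (ω : Sample κ ι) (u : User)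

lemma sum_user {M : Type*} [AddCommMonoid M] (u : User) (f : User → M) :
    ∑ w, f w = f u + f u.other := by
  rw [User.univ_eq u, Finset.sum_pair u.other_ne.symm]

lemma relayTx_of_only {C : Codec κ ι} {E : ℝ} {ω : Sample κ ι} {u : User}
    (h : RelayOK C E ω u) (h' : ¬ RelayOK C E ω u.other) (i : ι) :
    relayTx C E ω i = tx C E ω u i := by
  have h1 : relayDecoded C E ω u = ω.bits u := h
  rw [relayTx, sum_user u, if_pos h, if_neg h', add_zero, h1, tx]

lemma relayTx_of_both {C : Codec κ ι} {E : ℝ} {ω : Sample κ ι} {u : User}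
    (h : RelayOK C E ω u) (h' : RelayOK C E ω u.other) (i : ι) :
    relayTx C E ω i = tx C E ω u i + tx C E ω u.other i := by
  have h1 : relayDecoded C E ω u = ω.bits u := h
  have h2 : relayDecoded C E ω u.other = ω.bits u.other := h'
  rw [relayTx, sum_user u, if_pos h, if_pos h', h1, h2, tx, tx]

/-- The block decoded at the destination with the combiner `f`. -/
noncomputable def combineDecode (f : ℂ × ℂ × ℂ) : κ → ZMod 2 :=
  C.dec (hardBits (combinerGain f) E (C.enc (ω.bits u)) (combineNoise u f ω.dest.2))

variable {C E N0 ω u}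

lemma destDecoded_of_not (h : ¬ RelayOK C E ω u) :
    destDecoded C E N0 ω u = combineDecode C E ω u (directCombiner u ω.dest.1) := by
  rw [destDecoded, combineDecode]
  congr 1
  refine hardBit_eq_hardBits fun i => re_eq_of_eq_add ?_
  rw [decisionVar, if_neg h, combinerGain_direct, ← conj_mul_self_eq, destRx, tx]
  simp only [directCombiner, Sample.dest]
  ring

lemma destDecoded_of_only (h : RelayOK C E ω u) (h' : ¬ RelayOK C E ω u.other) :
    destDecoded C E N0 ω u = combineDecode C E ω u (mrcCombiner u ω.dest.1) := by
  rw [destDecoded, combineDecode]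
  congr 1
  refine hardBit_eq_hardBits fun i => re_eq_of_eq_add ?_
  rw [decisionVar, if_pos h, if_neg h', combinerGain_mrc, Complex.ofReal_add, ← conj_mul_self_eq,
    ← conj_mul_self_eq, destRx, destRxRelay, relayTx_of_only h h', tx]
  simp only [mrcCombiner, Sample.dest]
  ring

lemma destDecoded_of_second (h : RelayOK C E ω u) (h' : RelayOK C E ω u.other)
    (hs : ¬ nulledSNR E N0 ω u.other ≤ nulledSNR E N0 ω u) :
    destDecoded C E N0 ω u = combineDecode C E ω u (mrcCombiner u ω.dest.1) := by
  rw [destDecoded, combineDecode]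
  congr 1
  refine hardBit_eq_hardBits fun i => re_eq_of_eq_add ?_
  rw [decisionVar, if_pos h, if_pos h', if_neg hs, combinerGain_mrc, Complex.ofReal_add,
    ← conj_mul_self_eq, ← conj_mul_self_eq, destRx, destRxRelay, relayTx_of_both h h', tx, tx]
  simp only [mrcCombiner, Sample.dest]
  ring

lemma destDecoded_of_first (h : RelayOK C E ω u) (h' : RelayOK C E ω u.other)
    (hs : nulledSNR E N0 ω u.other ≤ nulledSNR E N0 ω u) :
    destDecoded C E N0 ω u = combineDecode C E ω u (nullCombiner u ω.dest.1) := by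
  rw [destDecoded, combineDecode]
  congr 1
  refine hardBit_eq_hardBits fun i => re_eq_of_eq_add ?_
  rw [decisionVar, if_pos h, if_pos h', if_pos hs, combinerGain_null, Complex.ofReal_add,
    ← conj_mul_self_eq, ← conj_mul_self_eq, nulledRx, nulledGain, destRx, destRx, destRxRelay,
    relayTx_of_both h h', tx, tx]
  simp only [nullCombiner, Sample.dest, interfererNorm]
  ring

/-- The user that is detected first has the larger direct gain. -/
lemma norm_sq_le_of_nulledSNR_le (hE : 0 < E / N0)
    (h : nulledSNR E N0 ω u.other ≤ nulledSNR E N0 ω u) :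
    ‖ω.hUD u.other‖ ^ 2 ≤ ‖ω.hUD u‖ ^ 2 := by
  by_contra! hlt
  have h1 := le_of_mul_le_mul_right h hE
  rw [User.other_other] at h1
  simp only [norm_mul, mul_pow] at h1
  set x := ‖ω.hUD u‖ ^ 2
  set y := ‖ω.hUD u.other‖ ^ 2
  set z := ‖ω.hRD‖ ^ 2
  have hx : 0 ≤ x := sq_nonneg _
  have hz : 0 ≤ z := sq_nonneg _
  have hy : 0 < y := hx.trans_lt hlt
  rcases hz.eq_or_lt with hz0 | hz0
  · rw [← hz0] at h1; simp at h1; linarith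
  · have e : y + x * z / (x + z) - (x + y * z / (y + z)) =
        (y - x) * ((x * y + x * z + y * z) / ((x + z) * (y + z))) := by
      field_simp
      ring
    have : 0 < (y - x) * ((x * y + x * z + y * z) / ((x + z) * (y + z))) :=
      mul_pos (by linarith) (by positivity)
    linarith

end Scheme

/-! ### Averages over the fading -/

/-- A combination of exponentials `∑ k, c k * exp (-(t k * x))`, with values in `[0, ∞]`. -/
noncomputable def expSum {m : ℕ} (c t : Fin m → ℝ) (x : ℝ) : ℝ≥0∞ :=
  ENNReal.ofReal (∑ k, c k * Real.exp (-(t k * x)))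

section Averages

variable {m : ℕ} {c t : Fin m → ℝ} {lam : ℝ}

lemma expSum_eq (hc : ∀ k, 0 ≤ c k) (x : ℝ) :
    expSum c t x = ∑ k, ENNReal.ofReal (c k) * ENNReal.ofReal (Real.exp (-(t k * x))) := by
  rw [expSum, ENNReal.ofReal_sum_of_nonneg fun k _ => mul_nonneg (hc k) (Real.exp_pos _).le]
  exact Finset.sum_congr rfl fun k _ => ENNReal.ofReal_mul (hc k)

lemma measurable_expSum : Measurable (expSum c t) := by
  unfold expSum; fun_prop

lemma expSum_anti (hc : ∀ k, 0 ≤ c k) (ht : ∀ k, 0 ≤ t k) : Antitone (expSum c t) := by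
  intro x y hxy
  refine ENNReal.ofReal_le_ofReal (Finset.sum_le_sum fun k _ => ?_)
  have := mul_le_mul_of_nonneg_left hxy (ht k)
  have h2 : Real.exp (-(t k * y)) ≤ Real.exp (-(t k * x)) := Real.exp_le_exp.2 (by linarith)
  exact mul_le_mul_of_nonneg_left h2 (hc k)

lemma ofReal_sum_eq (hc : ∀ k, 0 ≤ c k) {f : Fin m → ℝ} (hf : ∀ k, 0 ≤ f k) :
    ∑ k, ENNReal.ofReal (c k) * ENNReal.ofReal (f k) = ENNReal.ofReal (∑ k, c k * f k) := by
  rw [ENNReal.ofReal_sum_of_nonneg fun k _ => mul_nonneg (hc k) (hf k)]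
  exact Finset.sum_congr rfl fun k _ => (ENNReal.ofReal_mul (hc k)).symm

lemma lintegral_expSum (hlam : 0 < lam) (hc : ∀ k, 0 ≤ c k) (ht : ∀ k, 0 ≤ t k) :
    ∫⁻ z, expSum c t (‖z‖ ^ 2) ∂complexGaussian (1 / lam) =
      ENNReal.ofReal (∑ k, c k * (lam / (t k + lam))) := by
  simp_rw [expSum_eq hc]
  rw [lintegral_finsetSum _ fun k _ => by fun_prop,
    ← ofReal_sum_eq hc fun k => div_nonneg hlam.le (add_nonneg (ht k) hlam.le)]
  refine Finset.sum_congr rfl fun k _ => ?_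
  rw [lintegral_const_mul _ (by fun_prop), lintegral_exp_norm_sq hlam (ht k)]

lemma lintegral_expSum_add (hlam : 0 < lam) (hc : ∀ k, 0 ≤ c k) (ht : ∀ k, 0 ≤ t k) :
    ∫⁻ p, expSum c t (‖p.1‖ ^ 2 + ‖p.2‖ ^ 2)
      ∂(complexGaussian (1 / lam)).prod (complexGaussian (1 / lam)) =
      ENNReal.ofReal (∑ k, c k * (lam / (t k + lam)) ^ 2) := by
  have hpos (k) : 0 ≤ lam / (t k + lam) := div_nonneg hlam.le (add_nonneg (ht k) hlam.le)
  simp_rw [expSum_eq hc]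
  rw [lintegral_finsetSum _ fun k _ => by fun_prop, ← ofReal_sum_eq hc fun k => sq_nonneg _]
  refine Finset.sum_congr rfl fun k _ => ?_
  rw [lintegral_const_mul _ (by fun_prop), lintegral_prod _ (by fun_prop)]
  have : ∀ x y : ℂ, ENNReal.ofReal (Real.exp (-(t k * (‖x‖ ^ 2 + ‖y‖ ^ 2)))) =
      ENNReal.ofReal (Real.exp (-(t k * ‖x‖ ^ 2))) *
        ENNReal.ofReal (Real.exp (-(t k * ‖y‖ ^ 2))) := by
    intro x y
    rw [← ENNReal.ofReal_mul (Real.exp_pos _).le, ← Real.exp_add]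
    congr 2; ring
  simp_rw [this]
  simp_rw [lintegral_const_mul _ (by fun_prop : Measurable fun z : ℂ =>
    ENNReal.ofReal (Real.exp (-(t k * ‖z‖ ^ 2)))), lintegral_exp_norm_sq hlam (ht k)]
  rw [lintegral_mul_const _ (by fun_prop), lintegral_exp_norm_sq hlam (ht k),
    ← ENNReal.ofReal_mul (hpos k), pow_two]

lemma lintegral_expSum_of_le (hlam : 0 < lam) (hc : ∀ k, 0 ≤ c k) (ht : ∀ k, 0 ≤ t k) :
    ∫⁻ p in {p : ℂ × ℂ | ‖p.1‖ ^ 2 ≤ ‖p.2‖ ^ 2}, expSum c t (‖p.2‖ ^ 2)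
      ∂(complexGaussian (1 / lam)).prod (complexGaussian (1 / lam)) =
      ENNReal.ofReal (∑ k, c k * (lam / (t k + lam) * (lam / (t k + 2 * lam)))) := by
  have hpos (k) : 0 ≤ lam / (t k + lam) * (lam / (t k + 2 * lam)) := by
    have := ht k; positivity
  have hm : MeasurableSet {p : ℂ × ℂ | ‖p.1‖ ^ 2 ≤ ‖p.2‖ ^ 2} :=
    measurableSet_le (by fun_prop) (by fun_prop)
  simp_rw [expSum_eq hc]
  rw [lintegral_finsetSum _ fun k _ => by fun_prop, ← ofReal_sum_eq hc hpos]
  refine Finset.sum_congr rfl fun k _ => ?_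
  rw [lintegral_const_mul _ (by fun_prop), ← lintegral_indicator hm, lintegral_prod _
    (Measurable.indicator (by fun_prop) hm).aemeasurable,
    ← lintegral_indicator_le_exp_norm_sq hlam (ht k)]
  rfl

end Averages

section Gains

variable {lam : ℝ}

lemma measurePreserving_gain_direct (lam : ℝ) (u : User) :
    MeasurePreserving (fun γ : (User → ℂ) × ℂ => γ.1 u) (gainLaw lam)
      (complexGaussian (1 / lam)) :=
  (measurePreserving_eval (fun _ : User => complexGaussian (1 / lam)) u).comp
    measurePreserving_fst

lemma measurePreserving_gain_relay (lam : ℝ) (u : User) :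
    MeasurePreserving (fun γ : (User → ℂ) × ℂ => (γ.1 u, γ.2)) (gainLaw lam)
      ((complexGaussian (1 / lam)).prod (complexGaussian (1 / lam))) :=
  (measurePreserving_eval (fun _ : User => complexGaussian (1 / lam)) u).prod
    (MeasurePreserving.id _)

lemma measurePreserving_gain_users (lam : ℝ) (u : User) :
    MeasurePreserving (fun γ : (User → ℂ) × ℂ => (γ.1 u.other, γ.1 u)) (gainLaw lam)
      ((complexGaussian (1 / lam)).prod (complexGaussian (1 / lam))) := by
  have h := (measurePreserving_eval_user_pair (complexGaussian (1 / lam)) u.other).comp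
    (measurePreserving_fst (μ := Measure.pi fun _ : User => complexGaussian (1 / lam))
      (ν := complexGaussian (1 / lam)))
  simp only [Function.comp_def, User.other_other] at h
  exact h

end Gains

/-! ### Error events at the destination, given the bits -/

lemma measurable_combinerGain : Measurable combinerGain := by
  unfold combinerGain; fun_prop

lemma measurable_combineNoise {ι : Type} (u : User) {f : (User → ℂ) × ℂ → ℂ × ℂ × ℂ} (hf : Measurable f) :
    Measurable fun d : DestSample ι => combineNoise u (f d.1) d.2 := by
  unfold combineNoise
  refine measurable_pi_lambda _ fun i => Complex.measurable_re.comp ?_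
  fun_prop

section Destination

variable {κ ι : Type} [Fintype ι] (C : Codec κ ι) (E : ℝ) (u : User) (j : κ)

/-- The event that the combiner `f` produces an error at bit `j`, while the gains are in `H`. -/
def errorEvent (f : (User → ℂ) × ℂ → ℂ × ℂ × ℂ) (H : Set ((User → ℂ) × ℂ))
    (b : User → κ → ZMod 2) : Set (DestSample ι) :=
  {d | d.1 ∈ H ∧ hardBits (combinerGain (f d.1)) E (C.enc (b u)) (combineNoise u (f d.1) d.2) ∈
    {y | C.dec y j ≠ b u j}}

lemma noiseLaw_map_combineNoise {N : ℝ} (hN : 0 ≤ N) (f : ℂ × ℂ × ℂ) :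
    (noiseLaw ι N).map (combineNoise u f) = combinedNoise ι (combinerGain f) N :=
  noiseLaw_map_re hN u f.1 f.2.1 f.2.2

variable {C E u j}

lemma errorEvent_spec {f : (User → ℂ) × ℂ → ℂ × ℂ × ℂ} (hf : Measurable f)
    {H : Set ((User → ℂ) × ℂ)} (hH : MeasurableSet H) (b : User → κ → ZMod 2) (lam : ℝ) {N0 : ℝ}
    (hN : 0 < N0) :
    MeasurableSet (errorEvent C E u j f H b) ∧
    destLaw ι lam N0 (errorEvent C E u j f H b) =
      ∫⁻ γ in H, combinedNoise ι (combinerGain (f γ)) N0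
        {w | C.dec (hardBits (combinerGain (f γ)) E (C.enc (b u)) w) j ≠ b u j} ∂gainLaw lam :=
  prod_hardBits E (measurable_combineNoise u hf) (measurable_combinerGain.comp hf)
    (fun γ => noiseLaw_map_combineNoise u hN.le (f γ)) hH _ _

lemma measurable_directCombiner : Measurable (directCombiner u) := by
  unfold directCombiner; fun_prop

lemma measurable_mrcCombiner : Measurable (mrcCombiner u) := by
  unfold mrcCombiner; fun_prop

lemma measurable_nullCombiner : Measurable (nullCombiner u) := by
  unfold nullCombiner interfererNorm; fun_prop

variable {lam N0 : ℝ} {m : ℕ} {c t : Fin m → ℝ}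

/-- A bound `φ` on the error probability at a given combined gain can be averaged over the
gains. -/
lemma destLaw_errorEvent_le (hlam : 0 < lam) (hN : 0 < N0) {φ : ℝ → ℝ≥0∞}
    {b : User → κ → ZMod 2} (hφ : ∀ G, 0 < G → combinedNoise ι G N0
      {w | C.dec (hardBits G E (C.enc (b u)) w) j ≠ b u j} ≤ φ G)
    {f : (User → ℂ) × ℂ → ℂ × ℂ × ℂ} (hf : Measurable f) (hfu : ∀ γ, (f γ).1 = conj (γ.1 u))
    {H : Set ((User → ℂ) × ℂ)} (hH : MeasurableSet H) :
    destLaw ι lam N0 (errorEvent C E u j f H b) ≤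
      ∫⁻ γ in H, φ (combinerGain (f γ)) ∂gainLaw lam := by
  rw [(errorEvent_spec hf hH b lam hN).2]
  refine lintegral_mono_ae (ae_restrict_of_ae ?_)
  filter_upwards [(measurePreserving_gain_direct lam u).quasiMeasurePreserving.ae
    (ae_norm_sq_pos hlam)] with γ hγ
  exact hφ _ (hγ.trans_le (norm_sq_le_combinerGain (hfu γ)))

lemma destLaw_direct_le (hlam : 0 < lam) (hN : 0 < N0) (hc : ∀ k, 0 ≤ c k) (ht : ∀ k, 0 ≤ t k)
    {b : User → κ → ZMod 2} (hφ : ∀ G, 0 < G → combinedNoise ι G N0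
      {w | C.dec (hardBits G E (C.enc (b u)) w) j ≠ b u j} ≤ expSum c t G) :
    destLaw ι lam N0 (errorEvent C E u j (directCombiner u) Set.univ b) ≤
      ENNReal.ofReal (∑ k, c k * (lam / (t k + lam))) := by
  refine (destLaw_errorEvent_le hlam hN hφ measurable_directCombiner (fun _ => rfl)
    MeasurableSet.univ).trans_eq ?_
  simp_rw [Measure.restrict_univ, combinerGain_direct]
  rw [← lintegral_expSum hlam hc ht]
  exact (measurePreserving_gain_direct lam u).lintegral_comp
    (measurable_expSum.comp (by fun_prop : Measurable fun z : ℂ => ‖z‖ ^ 2))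

lemma destLaw_mrc_le (hlam : 0 < lam) (hN : 0 < N0) (hc : ∀ k, 0 ≤ c k) (ht : ∀ k, 0 ≤ t k)
    {b : User → κ → ZMod 2} (hφ : ∀ G, 0 < G → combinedNoise ι G N0
      {w | C.dec (hardBits G E (C.enc (b u)) w) j ≠ b u j} ≤ expSum c t G) :
    destLaw ι lam N0 (errorEvent C E u j (mrcCombiner u) Set.univ b) ≤
      ENNReal.ofReal (∑ k, c k * (lam / (t k + lam)) ^ 2) := by
  refine (destLaw_errorEvent_le hlam hN hφ measurable_mrcCombiner (fun _ => rfl)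
    MeasurableSet.univ).trans_eq ?_
  simp_rw [Measure.restrict_univ, combinerGain_mrc]
  rw [← lintegral_expSum_add hlam hc ht]
  exact (measurePreserving_gain_relay lam u).lintegral_comp
    (measurable_expSum.comp (by fun_prop : Measurable fun p : ℂ × ℂ => ‖p.1‖ ^ 2 + ‖p.2‖ ^ 2))

/-- The gains for which the direct channel of user `u` is the better one. -/
def strongerGains (u : User) : Set ((User → ℂ) × ℂ) := {γ | ‖γ.1 u.other‖ ^ 2 ≤ ‖γ.1 u‖ ^ 2}

lemma measurableSet_strongerGains : MeasurableSet (strongerGains u) :=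
  measurableSet_le (by fun_prop) (by fun_prop)

/-- For the user that is detected first it suffices to keep the direct part of its SNR. -/
lemma destLaw_null_le (hlam : 0 < lam) (hN : 0 < N0) (hc : ∀ k, 0 ≤ c k) (ht : ∀ k, 0 ≤ t k)
    {b : User → κ → ZMod 2} (hφ : ∀ G, 0 < G → combinedNoise ι G N0
      {w | C.dec (hardBits G E (C.enc (b u)) w) j ≠ b u j} ≤ expSum c t G) :
    destLaw ι lam N0 (errorEvent C E u j (nullCombiner u) (strongerGains u) b) ≤
      ENNReal.ofReal (∑ k, c k * (lam / (t k + lam) * (lam / (t k + 2 * lam)))) := by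
  refine (destLaw_errorEvent_le hlam hN hφ measurable_nullCombiner (fun _ => rfl)
    measurableSet_strongerGains).trans ?_
  rw [← lintegral_expSum_of_le hlam hc ht]
  have hm : MeasurableSet {p : ℂ × ℂ | ‖p.1‖ ^ 2 ≤ ‖p.2‖ ^ 2} :=
    measurableSet_le (by fun_prop) (by fun_prop)
  refine (lintegral_mono fun γ => expSum_anti hc ht (norm_sq_le_combinerGain rfl)).trans_eq ?_
  exact (measurePreserving_gain_users lam u).setLIntegral_comp_preimage hm
    (measurable_expSum.comp (by fun_prop : Measurable fun p : ℂ × ℂ => ‖p.2‖ ^ 2))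

end Destination

/-! ### The relay -/

section Relay

variable {κ ι : Type} [Fintype ι] {C : Codec κ ι} {E : ℝ} {u : User}

/-- The event that the relay decodes the block of user `u` correctly, given the bits. -/
def relayOKSet (C : Codec κ ι) (E : ℝ) (u : User) (b : User → κ → ZMod 2) : Set (RelaySample ι) :=
  {r | C.dec (fun i => hardBit (conj (r.1 u) * (r.1 u * bpsk E (C.enc (b u) i) + r.2 u i))) = b u}

lemma relayOKSet_spec (E : ℝ) (C : Codec κ ι) (u : User) (b : User → κ → ZMod 2) (lamR : ℝ) {N0 : ℝ}
    (hN : 0 < N0) :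
    MeasurableSet (relayOKSet C E u b) ∧
    relayLaw ι lamR N0 (relayOKSet C E u b)ᶜ =
      ∫⁻ h, combinedNoise ι (‖h‖ ^ 2) N0
        {w | C.dec (hardBits (‖h‖ ^ 2) E (C.enc (b u)) w) ≠ b u} ∂complexGaussian (1 / lamR) := by
  set W : ℂ → (User → ι → ℂ) → ι → ℝ := fun h n i => (conj h * n u i).re
  set ν := Measure.pi fun _ : User => Measure.pi fun _ : ι => complexGaussian N0
  have hlaw (h : ℂ) : ν.map (W h) = combinedNoise ι (‖h‖ ^ 2) N0 := by
    have h1 := noiseLaw_map_re (ι := ι) hN.le u (conj h) 0 0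
    have h2 := (measurePreserving_fst (μ := ν)
      (ν := Measure.pi fun _ : ι => complexGaussian N0)).map_eq
    simp only [zero_mul, add_zero, norm_zero, RCLike.norm_conj, ne_eq, OfNat.ofNat_ne_zero,
      not_false_eq_true, zero_pow] at h1
    rw [combinedNoise, ← h1, ← h2, Measure.map_map (by fun_prop) (by fun_prop)]
    rfl
  obtain ⟨hm, hp⟩ := prod_hardBits (μ := complexGaussian (1 / lamR))
    (W := W) (G := fun h => ‖h‖ ^ 2) E (by fun_prop) (by fun_prop) hlaw MeasurableSet.univ
    (C.enc (b u)) {y | C.dec y ≠ b u}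
  have hpres : MeasurePreserving (fun r : RelaySample ι => (r.1 u, r.2)) (relayLaw ι lamR N0)
      ((complexGaussian (1 / lamR)).prod ν) :=
    (measurePreserving_eval (fun _ : User => complexGaussian (1 / lamR)) u).prod
      (MeasurePreserving.id _)
  have hset : (relayOKSet C E u b)ᶜ = (fun r : RelaySample ι => (r.1 u, r.2)) ⁻¹'
      {p | p.1 ∈ Set.univ ∧
        hardBits (‖p.1‖ ^ 2) E (C.enc (b u)) (W p.1 p.2) ∈ {y | C.dec y ≠ b u}} := by
    ext r
    have := hardBit_eq_hardBits (G := ‖r.1 u‖ ^ 2) (E := E) (e := C.enc (b u)) (w := W (r.1 u) r.2)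
      (T := fun i => conj (r.1 u) * (r.1 u * bpsk E (C.enc (b u) i) + r.2 u i))
      fun i => re_eq_of_eq_add (by rw [← conj_mul_self_eq]; ring)
    simp only [relayOKSet, Set.mem_compl_iff, Set.mem_ofPred_eq, Set.mem_univ, true_and, this,
      ne_eq, Set.mem_preimage]
  refine ⟨?_, ?_⟩
  · rw [← MeasurableSet.compl_iff, hset]
    exact hpres.measurable hm
  · rw [hset, hpres.measure_preimage hm.nullMeasurableSet, hp, Measure.restrict_univ]
    rfl

/-- The relay fails to decode a block with a probability of the order of the inverse SNR. -/
lemma relayLaw_fail_le {lamR N0 : ℝ} (hlam : 0 < lamR) (hN : 0 < N0) {m : ℕ} {c t : Fin m → ℝ}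
    (hc : ∀ k, 0 ≤ c k) (ht : ∀ k, 0 ≤ t k) {b : User → κ → ZMod 2}
    (hφ : ∀ G, 0 < G → combinedNoise ι G N0
      {w | C.dec (hardBits G E (C.enc (b u)) w) ≠ b u} ≤ expSum c t G) :
    relayLaw ι lamR N0 (relayOKSet C E u b)ᶜ ≤
      ENNReal.ofReal (∑ k, c k * (lamR / (t k + lamR))) := by
  rw [(relayOKSet_spec E C u b lamR hN).2, ← lintegral_expSum hlam hc ht]
  refine lintegral_mono_ae ?_
  filter_upwards [ae_norm_sq_pos hlam] with h hh
  exact hφ _ hh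

end Relay

/-! ### Upper bound on the bit error probability -/

section Upper

variable {κ ι : Type} [Fintype κ] [Fintype ι]

lemma law_real_separate_le (lam lamR N0 : ℝ) {D : (User → κ → ZMod 2) → Set (DestSample ι)}
    {A : (User → κ → ZMod 2) → Set (RelaySample ι)} (hD : ∀ b, MeasurableSet (D b))
    (hA : ∀ b, MeasurableSet (A b)) {x : ℝ} (hx : 0 ≤ x)
    (hDx : ∀ b, destLaw ι lam N0 (D b) ≤ ENNReal.ofReal x) :
    (law κ ι lam lamR N0).real {ω | ω.dest ∈ D ω.bits ∧ ω.relay ∈ A ω.bits} ≤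
      (law κ ι lam lamR N0).real {ω | ω.relay ∈ A ω.bits} * x := by
  have hfin : law κ ι lam lamR N0 {ω | ω.relay ∈ A ω.bits} ≠ ∞ := by
    rw [law_relay lam lamR N0 hA]
    refine ((lintegral_mono fun b => prob_le_one).trans_lt ?_).ne
    simp
  have h := law_separate_le lam lamR N0 hD hA hDx
  rw [measureReal_def, measureReal_def]
  refine (ENNReal.toReal_mono (ENNReal.mul_ne_top ENNReal.ofReal_ne_top hfin) h).trans_eq ?_
  rw [ENNReal.toReal_mul, ENNReal.toReal_ofReal hx, mul_comm]

instance (lam lamR N0 : ℝ) : IsProbabilityMeasure (law κ ι lam lamR N0) :=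
  inferInstanceAs (IsProbabilityMeasure ((bitLaw κ).prod _))

/-- A bound on the error probability at a given combined gain by exponentials yields a bound on the
bit error probability of the whole scheme. -/
theorem bep_le {C : Codec κ ι} {lam E N0 : ℝ} (lamR : ℝ) (hlam : 0 < lam) (hE : 0 < E)
    (hN : 0 < N0) (u : User) (j : κ) {m : ℕ} {c t : Fin m → ℝ} (hc : ∀ k, 0 ≤ c k)
    (ht : ∀ k, 0 ≤ t k) (hφ : ∀ b G, 0 < G → combinedNoise ι G N0
      {w | C.dec (hardBits G E (C.enc b) w) j ≠ b j} ≤ expSum c t G) :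
    bep C lam lamR E N0 u j ≤
      (stateProb C lam lamR E N0 u 0 + stateProb C lam lamR E N0 u 2) *
        (∑ k, c k * (lam / (t k + lam))) +
      stateProb C lam lamR E N0 u 1 * (∑ k, c k * (lam / (t k + lam)) ^ 2) +
      stateProb C lam lamR E N0 u 3 *
        (∑ k, c k * (lam / (t k + lam) * (lam / (t k + 2 * lam))) +
          ∑ k, c k * (lam / (t k + lam)) ^ 2) := by
  have hpos (k) : 0 ≤ lam / (t k + lam) := div_nonneg hlam.le (add_nonneg (ht k) hlam.le)
  have hpos' (k) : 0 ≤ lam / (t k + 2 * lam) :=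
    div_nonneg hlam.le (add_nonneg (ht k) (by linarith))
  set x1 := ∑ k, c k * (lam / (t k + lam))
  set x2 := ∑ k, c k * (lam / (t k + lam)) ^ 2
  set x3 := ∑ k, c k * (lam / (t k + lam) * (lam / (t k + 2 * lam)))
  have hx1 : 0 ≤ x1 := Finset.sum_nonneg fun k _ => mul_nonneg (hc k) (hpos k)
  have hx2 : 0 ≤ x2 := Finset.sum_nonneg fun k _ => mul_nonneg (hc k) (sq_nonneg _)
  have hx3 : 0 ≤ x3 := Finset.sum_nonneg fun k _ => mul_nonneg (hc k)
    (mul_nonneg (hpos k) (hpos' k))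
  set D1 : (User → κ → ZMod 2) → Set (DestSample ι) :=
    errorEvent C E u j (directCombiner u) Set.univ
  set D2 : (User → κ → ZMod 2) → Set (DestSample ι) :=
    errorEvent C E u j (mrcCombiner u) Set.univ
  set D3 : (User → κ → ZMod 2) → Set (DestSample ι) :=
    errorEvent C E u j (nullCombiner u) (strongerGains u)
  set A : (User → κ → ZMod 2) → Set (RelaySample ι) := relayOKSet C E u
  set A' : (User → κ → ZMod 2) → Set (RelaySample ι) := relayOKSet C E u.other
  have mD1 (b) : MeasurableSet (D1 b) :=
    (errorEvent_spec measurable_directCombiner MeasurableSet.univ b lam hN).1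
  have mD2 (b) : MeasurableSet (D2 b) :=
    (errorEvent_spec measurable_mrcCombiner MeasurableSet.univ b lam hN).1
  have mD3 (b) : MeasurableSet (D3 b) :=
    (errorEvent_spec measurable_nullCombiner measurableSet_strongerGains b lam hN).1
  have mA (b) : MeasurableSet (A b) := (relayOKSet_spec E C u b lamR hN).1
  have mA' (b) : MeasurableSet (A' b) := (relayOKSet_spec E C u.other b lamR hN).1
  have h0 := law_real_separate_le lam lamR N0 mD1 (fun b => (mA b).compl.inter (mA' b).compl) hx1
    fun b => destLaw_direct_le hlam hN hc ht (hφ (b u))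
  have h2 := law_real_separate_le lam lamR N0 mD1 (fun b => (mA b).compl.inter (mA' b)) hx1
    fun b => destLaw_direct_le hlam hN hc ht (hφ (b u))
  have h1 := law_real_separate_le lam lamR N0 mD2 (fun b => (mA b).inter (mA' b).compl) hx2
    fun b => destLaw_mrc_le hlam hN hc ht (hφ (b u))
  have h3 := law_real_separate_le lam lamR N0 (fun b => (mD3 b).union (mD2 b))
    (fun b => (mA b).inter (mA' b)) (add_nonneg hx3 hx2) fun b => by
      rw [ENNReal.ofReal_add hx3 hx2]
      exact (measure_union_le _ _).trans (add_le_add (destLaw_null_le hlam hN hc ht (hφ (b u)))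
        (destLaw_mrc_le hlam hN hc ht (hφ (b u))))
  have hsub : {ω : Sample κ ι | destDecoded C E N0 ω u j ≠ ω.bits u j} ⊆
      (({ω | ω.dest ∈ D1 ω.bits ∧ ω.relay ∈ (A ω.bits)ᶜ ∩ (A' ω.bits)ᶜ} ∪
        {ω | ω.dest ∈ D1 ω.bits ∧ ω.relay ∈ (A ω.bits)ᶜ ∩ A' ω.bits}) ∪
        {ω | ω.dest ∈ D2 ω.bits ∧ ω.relay ∈ A ω.bits ∩ (A' ω.bits)ᶜ}) ∪
        {ω | ω.dest ∈ D3 ω.bits ∪ D2 ω.bits ∧ ω.relay ∈ A ω.bits ∩ A' ω.bits} := by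
    intro ω hω
    have hω : destDecoded C E N0 ω u j ≠ ω.bits u j := hω
    by_cases hu : RelayOK C E ω u <;> by_cases hv : RelayOK C E ω u.other
    · right
      refine ⟨?_, hu, hv⟩
      by_cases hs : nulledSNR E N0 ω u.other ≤ nulledSNR E N0 ω u
      · rw [destDecoded_of_first hu hv hs] at hω
        exact Or.inl ⟨norm_sq_le_of_nulledSNR_le (div_pos hE hN) hs, hω⟩
      · rw [destDecoded_of_second hu hv hs] at hω
        exact Or.inr ⟨Set.mem_univ _, hω⟩
    · rw [destDecoded_of_only hu hv] at hω
      exact Or.inl (Or.inr ⟨⟨Set.mem_univ _, hω⟩, hu, hv⟩)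
    · rw [destDecoded_of_not hu] at hω
      exact Or.inl (Or.inl (Or.inr ⟨⟨Set.mem_univ _, hω⟩, hu, hv⟩))
    · rw [destDecoded_of_not hu] at hω
      exact Or.inl (Or.inl (Or.inl ⟨⟨Set.mem_univ _, hω⟩, hu, hv⟩))
  have hb : bep C lam lamR E N0 u j ≤ _ := (measureReal_mono hsub).trans
    ((measureReal_union_le _ _).trans (add_le_add_left ((measureReal_union_le _ _).trans
      (add_le_add_left (measureReal_union_le _ _) _)) _))
  refine hb.trans ?_
  have e0 : stateProb C lam lamR E N0 u 0 = (law κ ι lam lamR N0).real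
    {ω | ω.relay ∈ (A ω.bits)ᶜ ∩ (A' ω.bits)ᶜ} := rfl
  have e1 : stateProb C lam lamR E N0 u 1 = (law κ ι lam lamR N0).real
    {ω | ω.relay ∈ A ω.bits ∩ (A' ω.bits)ᶜ} := rfl
  have e2 : stateProb C lam lamR E N0 u 2 = (law κ ι lam lamR N0).real
    {ω | ω.relay ∈ (A ω.bits)ᶜ ∩ A' ω.bits} := rfl
  have e3 : stateProb C lam lamR E N0 u 3 = (law κ ι lam lamR N0).real
    {ω | ω.relay ∈ A ω.bits ∩ A' ω.bits} := rfl
  rw [e0, e1, e2, e3]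
  linarith

end Upper

/-! ### Lower bound on the bit error probability -/

section Lower

variable {κ ι : Type} [Fintype κ] [Fintype ι]

/-- A Viterbi decoder of an injective code returns every information block. -/
lemma IsViterbi.dec_enc {κ ι : Type} [Fintype ι] {C : Codec κ ι} (hC : IsViterbi C)
    (hinj : Function.Injective C.enc) (b : κ → ZMod 2) : C.dec (C.enc b) = b := by
  have h := hC (C.enc b) b
  rw [hammingDist_self, Nat.le_zero, hammingDist_eq_zero] at h
  exact (hinj h).symm

/-- In a deep fade of the direct link of user `u` and of its link to the relay, both the relay and
the destination err with a probability bounded below; the relay then does not help. -/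
lemma exists_le_bep {C : Codec κ ι} (hC : IsViterbi C) (hinj : Function.Injective C.enc) :
    ∃ q : ℝ, 0 < q ∧ ∀ {lam lamR E N0 : ℝ}, 0 < lam → 0 < lamR → 0 < E → 0 < N0 → ∀ u j,
      q * (lam * (N0 / E) / (1 + lam * (N0 / E))) *
        (q * (lamR * (N0 / E) / (1 + lamR * (N0 / E)))) ≤ bep C lam lamR E N0 u j := by
  obtain ⟨q, hq0, hq1, hq⟩ := exists_le_combinedNoise_hardBits_eq ι
  have hqt : q ≠ ∞ := (hq1.trans_lt ENNReal.one_lt_top).ne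
  refine ⟨q.toReal, ENNReal.toReal_pos hq0.ne' hqt, fun {lam lamR E N0} hlam hlamR hE hN u j => ?_⟩
  -- a code word whose information block differs from the given one at bit `j`
  have hflip (b : κ → ZMod 2) : ∃ y, C.dec y j ≠ b j := by
    classical
    refine ⟨C.enc (Function.update b j (b j + 1)), ?_⟩
    rw [hC.dec_enc hinj]
    simp
  have hcn {G : ℝ} (hG0 : 0 < G) (hG : G ≤ N0 / E) (b : κ → ZMod 2) :
      q ≤ combinedNoise ι G N0 {w | C.dec (hardBits G E (C.enc b) w) j ≠ b j} := by
    obtain ⟨y, hy⟩ := hflip b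
    refine (hq hG0 hE.le hN ((le_div_iff₀ hE).1 hG) (C.enc b) y).trans (measure_mono fun w hw => ?_)
    have hw : hardBits G E (C.enc b) w = y := hw
    simpa [hw] using hy
  have hm : MeasurableSet {z : ℂ | 0 < ‖z‖ ^ 2 ∧ ‖z‖ ^ 2 ≤ N0 / E} :=
    measurableSet_Ioc.preimage (by fun_prop : Measurable fun z : ℂ => ‖z‖ ^ 2)
  have hfade {l : ℝ} (hl : 0 < l) {F : ℂ → ℝ≥0∞}
      (hF : ∀ z : ℂ, 0 < ‖z‖ ^ 2 → ‖z‖ ^ 2 ≤ N0 / E → q ≤ F z) :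
      ENNReal.ofReal (q.toReal * (l * (N0 / E) / (1 + l * (N0 / E)))) ≤
        ∫⁻ z, F z ∂complexGaussian (1 / l) := by
    calc _ = q * ENNReal.ofReal (l * (N0 / E) / (1 + l * (N0 / E))) := by
          rw [ENNReal.ofReal_mul ENNReal.toReal_nonneg, ENNReal.ofReal_toReal hqt]
      _ ≤ q * complexGaussian (1 / l) {z | 0 < ‖z‖ ^ 2 ∧ ‖z‖ ^ 2 ≤ N0 / E} := by
          gcongr; exact le_complexGaussian_norm_sq_Ioc hl (by positivity)
      _ = ∫⁻ z in {z : ℂ | 0 < ‖z‖ ^ 2 ∧ ‖z‖ ^ 2 ≤ N0 / E}, q ∂complexGaussian (1 / l) := by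
          rw [setLIntegral_const]
      _ ≤ ∫⁻ z in {z : ℂ | 0 < ‖z‖ ^ 2 ∧ ‖z‖ ^ 2 ≤ N0 / E}, F z ∂complexGaussian (1 / l) :=
          setLIntegral_mono' hm fun z hz => hF z hz.1 hz.2
      _ ≤ _ := setLIntegral_le_lintegral _ _
  have hD (b : User → κ → ZMod 2) :
      ENNReal.ofReal (q.toReal * (lam * (N0 / E) / (1 + lam * (N0 / E)))) ≤
        destLaw ι lam N0 (errorEvent C E u j (directCombiner u) Set.univ b) := by
    set F : ℂ → ℝ≥0∞ := Set.indicator {z : ℂ | 0 < ‖z‖ ^ 2 ∧ ‖z‖ ^ 2 ≤ N0 / E} fun _ => q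
    refine (hfade hlam (F := F) fun z h1 h2 => by simp [F, h1, h2]).trans ?_
    rw [(errorEvent_spec measurable_directCombiner MeasurableSet.univ b lam hN).2,
      Measure.restrict_univ, ← (measurePreserving_gain_direct lam u).lintegral_comp
        (measurable_const.indicator hm)]
    refine lintegral_mono fun γ => ?_
    by_cases hγ : γ.1 u ∈ {z : ℂ | 0 < ‖z‖ ^ 2 ∧ ‖z‖ ^ 2 ≤ N0 / E}
    · simp only [Set.indicator_of_mem hγ, combinerGain_direct]
      exact hcn hγ.1 hγ.2 (b u)
    · simp only [Set.indicator_of_notMem hγ]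
      exact zero_le
  have hR (b : User → κ → ZMod 2) :
      ENNReal.ofReal (q.toReal * (lamR * (N0 / E) / (1 + lamR * (N0 / E)))) ≤
        relayLaw ι lamR N0 (relayOKSet C E u b)ᶜ := by
    rw [(relayOKSet_spec E C u b lamR hN).2]
    refine hfade hlamR fun z h1 h2 => (hcn h1 h2 (b u)).trans (measure_mono fun w hw h => hw ?_)
    exact congrFun h j
  have h := le_law_separate lam lamR N0
    (fun b => (errorEvent_spec (C := C) (E := E) (u := u) (j := j) measurable_directCombiner
      MeasurableSet.univ b lam hN).1)
    (fun b => (relayOKSet_spec E C u b lamR hN).1.compl) hD hR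
  rw [← ENNReal.ofReal_mul (by positivity)] at h
  rw [bep, measureReal_def]
  refine (ENNReal.ofReal_le_iff_le_toReal (measure_ne_top _ _)).1 (h.trans (measure_mono ?_))
  rintro ω ⟨hd, hr⟩
  have hu : ¬ RelayOK C E ω u := hr
  have := hd.2
  simp only [Set.mem_ofPred_eq]
  rw [destDecoded_of_not hu]
  exact this

end Lower

/-! ### The states of the relay -/

section States

variable {κ ι : Type} [Fintype κ] [Fintype ι]

lemma law_relay_fail_le {C : Codec κ ι} {lamR E N0 : ℝ} (lam : ℝ) (hlam : 0 < lamR) (hN : 0 < N0)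
    (u : User) {m : ℕ} {c t : Fin m → ℝ} (hc : ∀ k, 0 ≤ c k) (ht : ∀ k, 0 ≤ t k)
    (hφ : ∀ b G, 0 < G → combinedNoise ι G N0
      {w | C.dec (hardBits G E (C.enc b) w) ≠ b} ≤ expSum c t G) :
    (law κ ι lam lamR N0).real {ω | ¬ RelayOK C E ω u} ≤ ∑ k, c k * (lamR / (t k + lamR)) := by
  have h : law κ ι lam lamR N0 {ω | ω.relay ∈ (relayOKSet C E u ω.bits)ᶜ} ≤
      ENNReal.ofReal (∑ k, c k * (lamR / (t k + lamR))) := by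
    rw [law_relay lam lamR N0 fun b => (relayOKSet_spec E C u b lamR hN).1.compl]
    refine (lintegral_mono fun b =>
      relayLaw_fail_le (u := u) (b := b) hlam hN hc ht (hφ (b u))).trans_eq ?_
    simp
  have hset : {ω : Sample κ ι | ¬ RelayOK C E ω u} =
    {ω | ω.relay ∈ (relayOKSet C E u ω.bits)ᶜ} := rfl
  rw [hset, measureReal_def]
  refine ENNReal.toReal_le_of_le_ofReal (Finset.sum_nonneg fun k _ => ?_) h
  exact mul_nonneg (hc k) (div_nonneg hlam.le (add_nonneg (ht k) hlam.le))

lemma stateProb_nonneg (C : Codec κ ι) (lam lamR E N0 : ℝ) (u : User) (k : Fin 4) :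
    0 ≤ stateProb C lam lamR E N0 u k := by
  fin_cases k <;> exact measureReal_nonneg

lemma measurableSet_relayOK (C : Codec κ ι) (E : ℝ) (u : User) :
    MeasurableSet {ω : Sample κ ι | RelayOK C E ω u} := by
  have h := measurableSet_prod_of_forall fun b : User → κ → ZMod 2 =>
    (relayOKSet_spec E C u b 1 one_pos).1
  have hm : Measurable fun ω : Sample κ ι => (ω.bits, ω.relay) := by
    unfold Sample.bits Sample.relay Sample.hUR Sample.nUR; fun_prop
  exact hm h

lemma stateProb_fail_eq (C : Codec κ ι) (lam lamR E N0 : ℝ) (u : User) :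
    stateProb C lam lamR E N0 u 0 + stateProb C lam lamR E N0 u 2 =
      (law κ ι lam lamR N0).real {ω | ¬ RelayOK C E ω u} := by
  have := measureReal_inter_add_sdiff (μ := law κ ι lam lamR N0)
    (s := {ω | ¬ RelayOK C E ω u}) (measurableSet_relayOK C E u.other)
  rw [← this, add_comm]
  rfl

lemma stateProb_other_fail_eq (C : Codec κ ι) (lam lamR E N0 : ℝ) (u : User) :
    stateProb C lam lamR E N0 u 0 + stateProb C lam lamR E N0 u 1 =
      (law κ ι lam lamR N0).real {ω | ¬ RelayOK C E ω u.other} := by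
  have := measureReal_inter_add_sdiff (μ := law κ ι lam lamR N0)
    (s := {ω | ¬ RelayOK C E ω u.other}) (measurableSet_relayOK C E u)
  have e0 : stateProb C lam lamR E N0 u 0 = (law κ ι lam lamR N0).real
      ({ω | ¬ RelayOK C E ω u.other} \ {ω | RelayOK C E ω u}) := by
    rw [Set.sdiff_eq, Set.inter_comm]; rfl
  have e1 : stateProb C lam lamR E N0 u 1 = (law κ ι lam lamR N0).real
      ({ω | ¬ RelayOK C E ω u.other} ∩ {ω | RelayOK C E ω u}) := by
    rw [Set.inter_comm]; rfl
  rw [← this, e0, e1, add_comm]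

lemma stateProb_sum (C : Codec κ ι) (lam lamR E N0 : ℝ) (u : User) :
    stateProb C lam lamR E N0 u 0 + stateProb C lam lamR E N0 u 1 +
      stateProb C lam lamR E N0 u 2 + stateProb C lam lamR E N0 u 3 = 1 := by
  have h1 := stateProb_fail_eq C lam lamR E N0 u
  have h2 := measureReal_inter_add_sdiff (μ := law κ ι lam lamR N0)
    (s := {ω | RelayOK C E ω u}) (measurableSet_relayOK C E u.other)
  have h3 := probReal_add_probReal_compl (μ := law κ ι lam lamR N0) (measurableSet_relayOK C E u)
  have e1 : stateProb C lam lamR E N0 u 1 = (law κ ι lam lamR N0).real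
    ({ω | RelayOK C E ω u} \ {ω | RelayOK C E ω u.other}) := rfl
  have e3 : stateProb C lam lamR E N0 u 3 = (law κ ι lam lamR N0).real
    ({ω | RelayOK C E ω u} ∩ {ω | RelayOK C E ω u.other}) := rfl
  have e4 : (law κ ι lam lamR N0).real {ω | ¬ RelayOK C E ω u} =
    (law κ ι lam lamR N0).real {ω | RelayOK C E ω u}ᶜ := rfl
  linarith

end States

/-! ### Diversity order two -/

/-- A function that is of exact order `s ^ (-2)` has diversity order two. -/
lemma hasDiversityOrder_two {Pe : ℝ → ℝ} {a b : ℝ} (ha : 0 < a)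
    (hl : ∀ᶠ s in atTop, a / s ^ 2 ≤ Pe s) (hu : ∀ᶠ s in atTop, Pe s ≤ b / s ^ 2) :
    HasDiversityOrder Pe 2 := by
  have hlim (x : ℝ) : Tendsto (fun s : ℝ => 2 - Real.log x / Real.log s) atTop (𝓝 2) := by
    have : Tendsto (fun s : ℝ => Real.log x / Real.log s) atTop (𝓝 0) :=
      Real.tendsto_log_atTop.const_div_atTop _
    simpa using this.const_sub 2
  have hform {x s : ℝ} (hx : 0 < x) (hs : 1 < s) :
      2 - Real.log x / Real.log s = -Real.log (x / s ^ 2) / Real.log s := by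
    have h := Real.log_pos hs
    rw [Real.log_div hx.ne' (by positivity), Real.log_pow]
    field_simp
    push_cast
    ring
  have hev := eventually_gt_atTop (1 : ℝ)
  refine tendsto_of_tendsto_of_tendsto_of_le_of_le' (hlim b) (hlim a) ?_ ?_
  · filter_upwards [hl, hu, hev] with s h1 h2 hs
    have hpos : 0 < a / s ^ 2 := by positivity
    have hb : 0 < b := by
      have : 0 < b / s ^ 2 := hpos.trans_le (h1.trans h2)
      have hs2 : 0 < s ^ 2 := by positivity
      exact (div_pos_iff_of_pos_right hs2).1 this
    rw [hform hb hs]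
    exact div_le_div_of_nonneg_right (neg_le_neg (Real.log_le_log (hpos.trans_le h1) h2))
      (Real.log_pos hs).le
  · filter_upwards [hl, hev] with s h1 hs
    have hpos : 0 < a / s ^ 2 := by positivity
    rw [hform ha hs]
    exact div_le_div_of_nonneg_right (neg_le_neg (Real.log_le_log hpos h1)) (Real.log_pos hs).le

section Viterbi

variable {κ ι : Type} [Fintype ι] {C : Codec κ ι} {d : ℕ} {lam lamR E N0 : ℝ}

lemma viterbi_le_expSum (hC : IsViterbi C)
    (hd : ∀ b b', b' ≠ b → d ≤ hammingDist (C.enc b') (C.enc b)) (hE : 0 ≤ E) (hN : 0 < N0)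
    (b : κ → ZMod 2) {G : ℝ} (hG : 0 < G) :
    combinedNoise ι G N0 {w | C.dec (hardBits G E (C.enc b) w) ≠ b} ≤
      expSum (fun _ : Fin 1 => 2 ^ Fintype.card ι) (fun _ => E / N0 * (d / 2)) G := by
  simpa [expSum] using combinedNoise_viterbi_le hC (hd b) hG hE hN

/-- The bound on the bit error probability for Viterbi decoding of a code of minimum
distance `d`. -/
lemma viterbi_bep_le [Fintype κ] (hC : IsViterbi C)
    (hd : ∀ b b', b' ≠ b → d ≤ hammingDist (C.enc b') (C.enc b)) (lamR : ℝ) (hlam : 0 < lam)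
    (hE : 0 < E) (hN : 0 < N0) (u : User) (j : κ) :
    bep C lam lamR E N0 u j ≤ 2 ^ Fintype.card ι *
      ((stateProb C lam lamR E N0 u 0 + stateProb C lam lamR E N0 u 2) *
        (lam / (E / N0 * (d / 2) + lam)) +
      (stateProb C lam lamR E N0 u 1 + 2 * stateProb C lam lamR E N0 u 3) *
        (lam / (E / N0 * (d / 2) + lam)) ^ 2) := by
  have ht : 0 ≤ E / N0 * (d / 2) := by positivity
  have h := bep_le (C := C) lamR hlam hE hN u j (c := fun _ : Fin 1 => 2 ^ Fintype.card ι)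
    (t := fun _ => E / N0 * (d / 2)) (fun _ => by positivity) (fun _ => ht)
    fun b G hG => by
      refine (measure_mono fun w hw => ?_).trans (viterbi_le_expSum hC hd hE.le hN b hG)
      exact fun h => hw (congrFun h j)
  simp only [Finset.univ_unique, Finset.sum_const, Finset.card_singleton, one_smul] at h
  set t := E / N0 * (d / 2)
  have h1 : lam / (t + 2 * lam) ≤ lam / (t + lam) :=
    div_le_div_of_nonneg_left hlam.le (by linarith) (by linarith)
  have h2 : lam / (t + lam) * (lam / (t + 2 * lam)) ≤ (lam / (t + lam)) ^ 2 := by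
    rw [pow_two]; exact mul_le_mul_of_nonneg_left h1 (by positivity)
  have h3 := mul_le_mul_of_nonneg_left h2
    (mul_nonneg (stateProb_nonneg C lam lamR E N0 u 3)
      (by positivity : (0 : ℝ) ≤ 2 ^ Fintype.card ι))
  linarith

end Viterbi

section Diversity

variable {κ ι : Type} [Fintype ι] {C : Codec κ ι} {lam lamR N0 r : ℝ}

lemma one_le_hammingDist_enc (hinj : Function.Injective C.enc) (b b' : κ → ZMod 2) (h : b' ≠ b) :
    1 ≤ hammingDist (C.enc b') (C.enc b) :=
  hammingDist_pos.2 fun he => h (hinj he)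

variable [Fintype κ]

/-- At the symbol energy `r * (s * N0)` the relay fails with a probability `O(1 / s)`. -/
lemma law_relay_fail_le_div (hC : IsViterbi C) (hinj : Function.Injective C.enc) (lam : ℝ)
    (hlamR : 0 < lamR) (hN : 0 < N0) (hr : 0 < r) (u : User) {s : ℝ} (hs : 0 < s) :
    (law κ ι lam lamR N0).real {ω | ¬ RelayOK C (r * (s * N0)) ω u} ≤
      2 ^ Fintype.card ι * (2 * lamR / r) / s := by
  have hE : 0 < r * (s * N0) := by positivity
  have h := law_relay_fail_le lam hlamR hN u (fun _ => by positivity) (fun _ => by positivity)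
    fun b G hG => viterbi_le_expSum hC (one_le_hammingDist_enc hinj) hE.le hN b hG
  simp only [Finset.univ_unique, Finset.sum_const, Finset.card_singleton, one_smul] at h
  refine h.trans ?_
  rw [mul_div_assoc (2 ^ Fintype.card ι : ℝ)]
  refine mul_le_mul_of_nonneg_left ?_ (by positivity)
  rw [show r * (s * N0) / N0 * ((1 : ℕ) / 2) = r * s / 2 by push_cast; field_simp, div_div,
    div_le_div_iff₀ (by positivity) (by positivity)]
  nlinarith [mul_pos hlamR hlamR]

/-- The relay eventually forwards both blocks. -/
theorem tendsto_stateProb (hC : IsViterbi C) (hinj : Function.Injective C.enc) (lam : ℝ)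
    (hlamR : 0 < lamR) (hN : 0 < N0) (hr : 0 < r) (u : User) :
    Tendsto (fun s => stateProb C lam lamR (r * (s * N0)) N0 u) atTop (𝓝 ![0, 0, 0, 1]) := by
  set B : ℝ := 2 ^ Fintype.card ι * (2 * lamR / r)
  have hB : Tendsto (fun s : ℝ => B / s) atTop (𝓝 0) := tendsto_id.const_div_atTop _
  have h02 : ∀ᶠ s in atTop, stateProb C lam lamR (r * (s * N0)) N0 u 0 +
      stateProb C lam lamR (r * (s * N0)) N0 u 2 ≤ B / s := by
    filter_upwards [eventually_gt_atTop 0] with s hs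
    rw [stateProb_fail_eq]
    exact law_relay_fail_le_div hC hinj lam hlamR hN hr u hs
  have h01 : ∀ᶠ s in atTop, stateProb C lam lamR (r * (s * N0)) N0 u 0 +
      stateProb C lam lamR (r * (s * N0)) N0 u 1 ≤ B / s := by
    filter_upwards [eventually_gt_atTop 0] with s hs
    rw [stateProb_other_fail_eq]
    exact law_relay_fail_le_div hC hinj lam hlamR hN hr u.other hs
  have nn (s : ℝ) (k : Fin 4) : 0 ≤ stateProb C lam lamR (r * (s * N0)) N0 u k :=
    stateProb_nonneg _ _ _ _ _ _ _
  have t0 : Tendsto (fun s => stateProb C lam lamR (r * (s * N0)) N0 u 0) atTop (𝓝 0) :=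
    squeeze_zero' (.of_forall fun s => nn s 0) (h02.mono fun s h => by linarith [nn s 2]) hB
  have t1 : Tendsto (fun s => stateProb C lam lamR (r * (s * N0)) N0 u 1) atTop (𝓝 0) :=
    squeeze_zero' (.of_forall fun s => nn s 1) (h01.mono fun s h => by linarith [nn s 0]) hB
  have t2 : Tendsto (fun s => stateProb C lam lamR (r * (s * N0)) N0 u 2) atTop (𝓝 0) :=
    squeeze_zero' (.of_forall fun s => nn s 2) (h02.mono fun s h => by linarith [nn s 0]) hB
  have t3 : Tendsto (fun s => stateProb C lam lamR (r * (s * N0)) N0 u 3) atTop (𝓝 1) := by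
    have h := ((t0.add t1).add t2).const_sub 1
    simp only [add_zero, sub_zero] at h
    refine h.congr fun s => ?_
    linarith [stateProb_sum C lam lamR (r * (s * N0)) N0 u]
  rw [tendsto_pi_nhds]
  intro k
  fin_cases k
  · exact t0
  · exact t1
  · exact t2
  · exact t3

/-- Both users have diversity order two.  Without the help of the relay an error costs a factor
`O(1 / s)`, but so does the failure of the relay. -/
theorem hasDiversityOrder_bep (hC : IsViterbi C) (hinj : Function.Injective C.enc)
    (hlam : 0 < lam) (hlamR : 0 < lamR) (hN : 0 < N0) (hr : 0 < r) (u : User) (j : κ) :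
    HasDiversityOrder (fun s => bep C lam lamR (r * (s * N0)) N0 u j) 2 := by
  obtain ⟨q, hq0, hq⟩ := exists_le_bep hC hinj
  set M : ℝ := 2 ^ Fintype.card ι with hM
  have hM0 : 0 < M := by positivity
  refine hasDiversityOrder_two
    (a := q * (lam / (r + lam)) * (q * (lamR / (r + lamR))))
    (b := M * (M * (2 * lamR / r) * (2 * lam / r) + 3 * (2 * lam / r) ^ 2)) (by positivity) ?_ ?_
  · filter_upwards [eventually_ge_atTop 1] with s hs
    have hs0 : 0 < s := by linarith
    have key {l : ℝ} (hl : 0 < l) : l / (r + l) / s ≤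
        l * (N0 / (r * (s * N0))) / (1 + l * (N0 / (r * (s * N0)))) := by
      have e : l * (N0 / (r * (s * N0))) / (1 + l * (N0 / (r * (s * N0)))) = l / (r * s + l) := by
        field_simp
      rw [e, div_div]
      exact div_le_div_of_nonneg_left hl.le (by positivity) (by nlinarith)
    refine le_trans ?_ (hq hlam hlamR (by positivity : 0 < r * (s * N0)) hN u j)
    have k1 := mul_le_mul_of_nonneg_left (key hlam) hq0.le
    have k2 := mul_le_mul_of_nonneg_left (key hlamR) hq0.le
    refine le_trans (le_of_eq ?_) (mul_le_mul k1 k2 (by positivity) (by positivity))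
    ring
  · filter_upwards [eventually_gt_atTop 0] with s hs
    have hE : 0 < r * (s * N0) := by positivity
    have h := viterbi_bep_le hC (one_le_hammingDist_enc hinj) lamR hlam hE hN u j
    have hf := law_relay_fail_le_div hC hinj lam hlamR hN hr u hs
    rw [← stateProb_fail_eq] at hf
    rw [show r * (s * N0) / N0 * ((1 : ℕ) / 2) = r * s / 2 by push_cast; field_simp] at h
    have hx : lam / (r * s / 2 + lam) ≤ 2 * lam / r / s := by
      rw [div_div, div_le_div_iff₀ (by positivity) (by positivity)]
      nlinarith [mul_pos hlam hlam]
    have hx0 : 0 ≤ lam / (r * s / 2 + lam) := by positivity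
    have hsum := stateProb_sum C lam lamR (r * (s * N0)) N0 u
    have nn := stateProb_nonneg C lam lamR (r * (s * N0)) N0 u
    have hp : stateProb C lam lamR (r * (s * N0)) N0 u 1 +
      2 * stateProb C lam lamR (r * (s * N0)) N0 u 3 ≤ 3 := by linarith [nn 0, nn 1, nn 2, nn 3]
    refine h.trans ?_
    rw [← hM]
    have b1 := mul_le_mul hf hx hx0 (by positivity)
    have b2 := mul_le_mul hp (pow_le_pow_left₀ hx0 hx 2) (by positivity) (by norm_num)
    calc _ ≤ M * (M * (2 * lamR / r) / s * (2 * lam / r / s) + 3 * (2 * lam / r / s) ^ 2) := by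
          gcongr
      _ = _ := by field_simp

end Diversity

/-! ### Convolutional codes -/

section Convolutional

variable {k₀ n₀ L : ℕ} {G : Matrix (Fin k₀) (Fin n₀) (ZMod 2)[X]}

/-- The input sequences of an information block, as polynomials. -/
noncomputable def inputPoly (b : Fin L × Fin k₀ → ZMod 2) (a : Fin k₀) : (ZMod 2)[X] :=
  ∑ t : Fin L, Polynomial.C (b (t, a)) * Polynomial.X ^ (t : ℕ)

lemma inputPoly_coeff (b : Fin L × Fin k₀ → ZMod 2) (a : Fin k₀) (t : Fin L) :
    (inputPoly b a).coeff t = b (t, a) := by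
  simp [inputPoly, Polynomial.finsetSum_coeff, Polynomial.coeff_C_mul, Polynomial.coeff_X_pow,
    Fin.val_inj]

lemma inputPoly_coeff_of_le (b : Fin L × Fin k₀ → ZMod 2) (a : Fin k₀) {n : ℕ} (hn : L ≤ n) :
    (inputPoly b a).coeff n = 0 := by
  rw [inputPoly, Polynomial.finsetSum_coeff]
  refine Finset.sum_eq_zero fun t _ => ?_
  rw [Polynomial.coeff_C_mul, Polynomial.coeff_X_pow, if_neg (by have := t.2; omega), mul_zero]

lemma inputPoly_sub (b b' : Fin L × Fin k₀ → ZMod 2) :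
    inputPoly (b' - b) = inputPoly b' - inputPoly b := by
  ext1 a
  simp [inputPoly, sub_mul]

lemma convEnc_eq (b : Fin L × Fin k₀ → ZMod 2) (x : Fin (L + memory G) × Fin n₀) :
    convEnc G L b x = (Matrix.vecMul (inputPoly b) G x.2).coeff x.1 := rfl

lemma natDegree_le_memory (a : Fin k₀) (i : Fin n₀) : (G a i).natDegree ≤ memory G :=
  (Finset.le_sup (f := fun i => (G a i).natDegree) (Finset.mem_univ i)).trans
    (Finset.le_sup (f := fun a => Finset.univ.sup fun i => (G a i).natDegree) (Finset.mem_univ a))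

/-- After the terminating zero frames the encoder is back in the zero state. -/
lemma vecMul_inputPoly_coeff_of_le (b : Fin L × Fin k₀ → ZMod 2) (i : Fin n₀) {n : ℕ}
    (hn : L + memory G ≤ n) : (Matrix.vecMul (inputPoly b) G i).coeff n = 0 := by
  rw [Matrix.vecMul, dotProduct, Polynomial.finsetSum_coeff]
  refine Finset.sum_eq_zero fun a _ => ?_
  rw [Polynomial.coeff_mul]
  refine Finset.sum_eq_zero fun p hp => ?_
  have hp := Finset.HasAntidiagonal.mem_antidiagonal.1 hp
  rcases le_or_gt L p.1 with h | h
  · rw [inputPoly_coeff_of_le b a h, zero_mul]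
  · rw [Polynomial.coeff_eq_zero_of_natDegree_lt (p := G a i) (n := p.2)
      ((natDegree_le_memory a i).trans_lt (by omega)), mul_zero]

lemma convEnc_injective
    (hG : Function.Injective fun v : Fin k₀ → (ZMod 2)[X] => Matrix.vecMul v G) :
    Function.Injective (convEnc G L) := by
  intro b b' h
  have h1 : Matrix.vecMul (inputPoly b) G = Matrix.vecMul (inputPoly b') G := by
    ext i n
    by_cases hn : n < L + memory G
    · exact congrFun h (⟨n, hn⟩, i)
    · rw [vecMul_inputPoly_coeff_of_le b i (not_lt.1 hn),
        vecMul_inputPoly_coeff_of_le b' i (not_lt.1 hn)]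
  have h2 : inputPoly b = inputPoly b' := hG h1
  ext ⟨t, a⟩
  rw [← inputPoly_coeff b a t, h2, inputPoly_coeff]

/-- The free distance bounds the distance of two code words of the terminated code: their
difference is a code sequence of finite weight. -/
lemma freeDist_le_hammingDist
    (hG : Function.Injective fun v : Fin k₀ → (ZMod 2)[X] => Matrix.vecMul v G)
    {b b' : Fin L × Fin k₀ → ZMod 2} (h : b' ≠ b) :
    freeDist G ≤ hammingDist (convEnc G L b') (convEnc G L b) := by
  classical
  set T : Finset (Fin (L + memory G) × Fin n₀) :=
    Finset.univ.filter fun x => convEnc G L b' x ≠ convEnc G L b x with hT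
  set S : Set (ℕ × Fin n₀) := {x | PowerSeries.coeff x.1 (∑ a,
    ((inputPoly (b' - b) a : (ZMod 2)[X]) : PowerSeries (ZMod 2)) *
      ((G a x.2 : (ZMod 2)[X]) : PowerSeries (ZMod 2))) ≠ 0} with hS
  have hcoeff (n : ℕ) (i : Fin n₀) : PowerSeries.coeff n (∑ a,
      ((inputPoly (b' - b) a : (ZMod 2)[X]) : PowerSeries (ZMod 2)) *
        ((G a i : (ZMod 2)[X]) : PowerSeries (ZMod 2))) =
      (Matrix.vecMul (inputPoly b') G i).coeff n - (Matrix.vecMul (inputPoly b) G i).coeff n := by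
    rw [← Polynomial.coeff_sub, ← Pi.sub_apply, ← Matrix.sub_vecMul, ← inputPoly_sub,
      Matrix.vecMul, dotProduct]
    simp only [← Polynomial.coe_mul, map_sum, Polynomial.coeff_coe, Polynomial.finsetSum_coeff]
  have hmem (x : Fin (L + memory G) × Fin n₀) :
      x ∈ T ↔ (Matrix.vecMul (inputPoly b') G x.2).coeff x.1 ≠
        (Matrix.vecMul (inputPoly b) G x.2).coeff x.1 := by
    rw [hT, Finset.mem_filter, convEnc_eq, convEnc_eq]; simp
  have hST : S = (fun x : Fin (L + memory G) × Fin n₀ => ((x.1 : ℕ), x.2)) '' (T : Set _) := by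
    ext ⟨n, i⟩
    simp only [hS, Set.mem_ofPred_eq, hcoeff, Set.mem_image, Finset.mem_coe, hmem, Prod.mk.injEq,
      Prod.exists, sub_ne_zero]
    constructor
    · intro hne
      by_cases hn : n < L + memory G
      · exact ⟨⟨n, hn⟩, i, hne, rfl, rfl⟩
      · rw [vecMul_inputPoly_coeff_of_le b i (not_lt.1 hn),
          vecMul_inputPoly_coeff_of_le b' i (not_lt.1 hn)] at hne
        exact absurd rfl hne
    · rintro ⟨m, i', hne, rfl, rfl⟩
      exact hne
  have hTne : T.Nonempty := by
    by_contra hcon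
    refine h (convEnc_injective hG (funext fun x => ?_))
    by_contra hx
    exact hcon ⟨x, by simpa [hT] using hx⟩
  have hSne : S.Nonempty := hST ▸ hTne.to_set.image _
  have hfin : S.Finite := hST ▸ T.finite_toSet.image _
  have hcard : S.ncard ≤ T.card := by
    rw [hST, ← Set.ncard_coe_finset T]
    exact Set.ncard_image_le T.finite_toSet
  have hle : freeDist G ≤ S.ncard :=
    Nat.sInf_le ⟨fun a => (inputPoly (b' - b) a : PowerSeries (ZMod 2)),
      hSne, hfin, rfl⟩
  refine hle.trans (hcard.trans_eq ?_)
  rw [hT, hammingDist]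

end Convolutional

/-! ### The uncoded scheme -/

lemma isViterbi_uncoded (κ : Type) [Fintype κ] : IsViterbi (Codec.uncoded κ) := fun y b => by
  simp [Codec.uncoded]

lemma uncoded_enc_injective (κ : Type) : Function.Injective (Codec.uncoded κ).enc :=
  Function.injective_id

lemma bepBound_eq (lam : ℝ) (p : Fin 4 → ℝ) (s : ℝ) :
    bepBound lam p s = 1 / 2 * ((p 0 + p 2) * (lam / (s + lam)) + p 1 * (lam / (s + lam)) ^ 2) +
      p 3 * bothForwardedBound lam s := by
  rw [bepBound, bothForwardedBound]; ring

/-- With the two-exponential bound on the Gaussian tail, the coefficient of `p 3` is at most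
`0.7 λ² / (s + λ)²`, while `bothForwardedBound` is asymptotic to `0.75 λ² / (s + λ)²`.  With the
one-exponential bound, even the exact SNR after nulling would only give `0.75 λ² / (s + λ)²`. -/
lemma eventually_le_bothForwardedBound {lam : ℝ} (hlam : 0 < lam) :
    ∀ᶠ s in atTop, 1 / 4 * (lam / (s + lam) * (lam / (s + 2 * lam))) +
      1 / 4 * (lam / (2 * s + lam) * (lam / (2 * s + 2 * lam))) +
      (1 / 4 * (lam / (s + lam)) ^ 2 + 1 / 4 * (lam / (2 * s + lam)) ^ 2) ≤
      bothForwardedBound lam s := by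
  have hl : 7 / 10 * lam ^ 2 < 3 / 4 * lam ^ 2 := by nlinarith [pow_pos hlam 2]
  filter_upwards [(tendsto_bothForwardedBound hlam).eventually_const_lt hl,
    eventually_ge_atTop lam] with s h1 hs
  have hs0 : 0 < s := by linarith
  refine le_of_mul_le_mul_left (le_trans ?_ h1.le) (by positivity : 0 < (s + lam) ^ 2)
  -- the ratio `y` tends to `1 / 2`
  set y := (s + lam) / (2 * s + lam) with hy
  have hy0 : 0 ≤ y := by positivity
  have hy1 : y ≤ 2 / 3 := by rw [hy, div_le_div_iff₀ (by positivity) (by norm_num)]; linarith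
  have h3 : lam / (s + lam) * (lam / (s + 2 * lam)) ≤ (lam / (s + lam)) ^ 2 := by
    rw [pow_two]
    refine mul_le_mul_of_nonneg_left ?_ (by positivity)
    exact div_le_div_of_nonneg_left hlam.le (by positivity) (by linarith)
  have e : (s + lam) ^ 2 * (1 / 4 * (lam / (s + lam)) ^ 2 +
      1 / 4 * (lam / (2 * s + lam) * (lam / (2 * s + 2 * lam))) +
      (1 / 4 * (lam / (s + lam)) ^ 2 + 1 / 4 * (lam / (2 * s + lam)) ^ 2)) =
      lam ^ 2 / 4 * (2 + y / 2 + y ^ 2) := by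
    rw [hy]; field_simp; ring
  calc _ ≤ (s + lam) ^ 2 * (1 / 4 * (lam / (s + lam)) ^ 2 +
      1 / 4 * (lam / (2 * s + lam) * (lam / (2 * s + 2 * lam))) +
      (1 / 4 * (lam / (s + lam)) ^ 2 + 1 / 4 * (lam / (2 * s + lam)) ^ 2)) := by gcongr
    _ = lam ^ 2 / 4 * (2 + y / 2 + y ^ 2) := e
    _ ≤ lam ^ 2 / 4 * (2 + 2 / 3 / 2 + (2 / 3) ^ 2) := by gcongr
    _ ≤ _ := by nlinarith [pow_pos hlam 2]

lemma uncoded_bep_le {κ : Type} [Fintype κ] {lam N0 s : ℝ} (lamR : ℝ) (hlam : 0 < lam)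
    (hN : 0 < N0) (hs : 0 < s) (u : User) (j : κ)
    (hboth : 1 / 4 * (lam / (s + lam) * (lam / (s + 2 * lam))) +
      1 / 4 * (lam / (2 * s + lam) * (lam / (2 * s + 2 * lam))) +
      (1 / 4 * (lam / (s + lam)) ^ 2 + 1 / 4 * (lam / (2 * s + lam)) ^ 2) ≤
      bothForwardedBound lam s) :
    bep (Codec.uncoded κ) lam lamR (s * N0) N0 u j ≤
      bepBound lam (stateProb (Codec.uncoded κ) lam lamR (s * N0) N0 u) s := by
  have hE : 0 < s * N0 := by positivity
  have h := bep_le (C := Codec.uncoded κ) lamR hlam hE hN u j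
    (c := ![1 / 4, 1 / 4]) (t := ![s, 2 * s])
    (fun k => by fin_cases k <;> norm_num) (fun k => by fin_cases k <;> simp [hs.le])
    fun b G hG => by
      have h := combinedNoise_uncoded_le hG hE.le hN b j
      rw [mul_div_cancel_right₀ _ hN.ne'] at h
      refine h.trans_eq ?_
      simp [expSum, Fin.sum_univ_two]
  simp only [Fin.sum_univ_two, Matrix.cons_val_zero, Matrix.cons_val_one] at h
  have nn := stateProb_nonneg (Codec.uncoded κ) lam lamR (s * N0) N0 u
  set p := stateProb (Codec.uncoded κ) lam lamR (s * N0) N0 u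
  have h1 : lam / (2 * s + lam) ≤ lam / (s + lam) :=
    div_le_div_of_nonneg_left hlam.le (by positivity) (by linarith)
  have h2 : (lam / (2 * s + lam)) ^ 2 ≤ (lam / (s + lam)) ^ 2 :=
    pow_le_pow_left₀ (by positivity) h1 2
  rw [bepBound_eq]
  have b1 := mul_le_mul_of_nonneg_left h1 (add_nonneg (nn 0) (nn 2))
  have b2 := mul_le_mul_of_nonneg_left h2 (nn 1)
  have b3 := mul_le_mul_of_nonneg_left hboth (nn 3)
  linarith

/-- The remainder of the coefficient of `p 3` after its leading term. -/
noncomputable def remainder (lam s : ℝ) : ℝ :=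
  bothForwardedBound lam s - 3 / 4 * lam ^ 2 * (1 / (s + lam)) ^ 2

lemma remainder_isLittleO {lam : ℝ} (hlam : 0 < lam) :
    remainder lam =o[atTop] fun s => (1 / (s + lam)) ^ 2 := by
  have hne : ∀ᶠ s in atTop, 0 < s + lam := by
    filter_upwards [eventually_gt_atTop 0] with s hs using by positivity
  rw [isLittleO_iff_tendsto' (hne.mono fun s hs h => absurd h (by positivity))]
  have h := (tendsto_bothForwardedBound hlam).sub_const (3 / 4 * lam ^ 2)
  rw [sub_self] at h
  refine h.congr' ?_
  filter_upwards [hne] with s hs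
  rw [remainder]
  field_simp

lemma bepBound_eq_asymptoticForm (lam : ℝ) (p : Fin 4 → ℝ) (s : ℝ) :
    bepBound lam p s =
      asymptoticForm (1 / 2) (lam ^ 2 / 2) (3 / 4 * lam ^ 2) (remainder lam) lam p s := by
  rw [bepBound_eq, asymptoticForm, remainder]
  ring

/-! ### The convolutionally coded scheme -/

section Coded

variable {k₀ n₀ L : ℕ} {G : Matrix (Fin k₀) (Fin n₀) (ZMod 2)[X]}

lemma rate_pos (hG : Function.Injective fun v : Fin k₀ → (ZMod 2)[X] => Matrix.vecMul v G)
    (a : Fin k₀) : (0 : ℝ) < k₀ / n₀ := by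
  have hk : 0 < k₀ := a.pos
  have hn : n₀ ≠ 0 := by
    rintro rfl
    have : (fun _ => 0 : Fin k₀ → (ZMod 2)[X]) = fun _ => 1 := hG (Subsingleton.elim _ _)
    exact zero_ne_one (congrFun this a)
  have : 0 < n₀ := Nat.pos_of_ne_zero hn
  positivity

lemma coded_bep_le (hG : Function.Injective fun v : Fin k₀ → (ZMod 2)[X] => Matrix.vecMul v G)
    {C : Codec (Fin L × Fin k₀) (Fin (L + memory G) × Fin n₀)} (hC : C.enc = convEnc G L)
    (hV : IsViterbi C) {lam N0 s : ℝ} (lamR : ℝ) (hlam : 0 < lam) (hN : 0 < N0) (hs : 0 < s)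
    (u : User) (j : Fin L × Fin k₀) :
    bep C lam lamR ((k₀ / n₀ : ℝ) * (s * N0)) N0 u j ≤
      asymptoticForm (2 ^ Fintype.card (Fin (L + memory G) × Fin n₀))
        (2 ^ Fintype.card (Fin (L + memory G) × Fin n₀) * lam ^ 2)
        (2 ^ Fintype.card (Fin (L + memory G) × Fin n₀) * (2 * lam ^ 2)) (fun _ => 0) lam
        (stateProb C lam lamR ((k₀ / n₀ : ℝ) * (s * N0)) N0 u)
        (s * ((k₀ / n₀ : ℝ) * freeDist G / 2)) := by
  have hr := rate_pos hG j.2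
  have h := viterbi_bep_le (d := freeDist G) hV
    (fun b b' hb => by rw [hC]; exact freeDist_le_hammingDist hG hb) lamR hlam
    (by positivity : 0 < (k₀ / n₀ : ℝ) * (s * N0)) hN u j
  rw [show (k₀ / n₀ : ℝ) * (s * N0) / N0 * (freeDist G / 2) =
    s * ((k₀ / n₀ : ℝ) * freeDist G / 2) by field_simp] at h
  refine h.trans_eq ?_
  rw [asymptoticForm, div_pow, one_div, inv_pow, div_eq_mul_inv (lam ^ 2)]
  ring

end Coded

end MARC

theorem mainTheorem3 (lam : ℝ) (hlam : 0 < lam) :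
    -- uncoded transmission of blocks of `n` bits, at SNR `s = P / N0`
    ((∃ α β γ : ℝ, 0 < α ∧ 0 < β ∧ 0 < γ ∧ ∃ ρ : ℝ → ℝ,
        (ρ =o[atTop] fun s => (1 / (s + lam)) ^ 2) ∧
        (∀ (p : Fin 4 → ℝ) (s : ℝ), 0 < s →
          MARC.bepBound lam p s = MARC.asymptoticForm α β γ ρ lam p s) ∧
        ∃ s₀ : ℝ, 0 < s₀ ∧ ∀ (n : ℕ) (lamR N0 : ℝ), 0 < lamR → 0 < N0 →
          ∀ (u : MARC.User) (j : Fin n) (s : ℝ), s₀ ≤ s →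
            MARC.bep (MARC.Codec.uncoded (Fin n)) lam lamR (s * N0) N0 u j ≤
                MARC.bepBound lam
                  (MARC.stateProb (MARC.Codec.uncoded (Fin n)) lam lamR (s * N0) N0 u) s ∧
            MARC.bep (MARC.Codec.uncoded (Fin n)) lam lamR (s * N0) N0 u j ≤
                MARC.asymptoticForm α β γ ρ lam
                  (MARC.stateProb (MARC.Codec.uncoded (Fin n)) lam lamR (s * N0) N0 u) s) ∧
      ∀ (n : ℕ) (lamR N0 : ℝ), 0 < lamR → 0 < N0 → ∀ (u : MARC.User) (j : Fin n),
        Tendsto (fun s => MARC.stateProb (MARC.Codec.uncoded (Fin n)) lam lamR (s * N0) N0 u)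
          atTop (𝓝 ![0, 0, 0, 1]) ∧
        MARC.HasDiversityOrder
          (fun s => MARC.bep (MARC.Codec.uncoded (Fin n)) lam lamR (s * N0) N0 u j) 2) ∧
    -- convolutionally coded transmission with energy `P` per information bit, at SNR
    -- `s = P / N0` and with `sc = s r d / 2`, `r` the rate and `d` the free distance
    (∀ (k₀ n₀ L : ℕ) (G : Matrix (Fin k₀) (Fin n₀) (Polynomial (ZMod 2))),
      Function.Injective (fun v : Fin k₀ → Polynomial (ZMod 2) => Matrix.vecMul v G) →
      (∃ α β γ : ℝ, 0 < α ∧ 0 < β ∧ 0 < γ ∧ ∃ ρ : ℝ → ℝ,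
        (ρ =o[atTop] fun s => (1 / (s + lam)) ^ 2) ∧
        ∀ C : MARC.Codec (Fin L × Fin k₀) (Fin (L + MARC.memory G) × Fin n₀),
          C.enc = MARC.convEnc G L → MARC.IsViterbi C →
          ∀ lamR N0 : ℝ, 0 < lamR → 0 < N0 →
          ∀ (u : MARC.User) (j : Fin L × Fin k₀) (s : ℝ), 0 < s →
            MARC.bep C lam lamR ((k₀ / n₀ : ℝ) * (s * N0)) N0 u j ≤
              MARC.asymptoticForm α β γ ρ lam
                (MARC.stateProb C lam lamR ((k₀ / n₀ : ℝ) * (s * N0)) N0 u)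
                (s * ((k₀ / n₀ : ℝ) * MARC.freeDist G / 2))) ∧
      ∀ C : MARC.Codec (Fin L × Fin k₀) (Fin (L + MARC.memory G) × Fin n₀),
        C.enc = MARC.convEnc G L → MARC.IsViterbi C →
        ∀ lamR N0 : ℝ, 0 < lamR → 0 < N0 → ∀ (u : MARC.User) (j : Fin L × Fin k₀),
          Tendsto (fun s => MARC.stateProb C lam lamR ((k₀ / n₀ : ℝ) * (s * N0)) N0 u)
            atTop (𝓝 ![0, 0, 0, 1]) ∧
          MARC.HasDiversityOrder
            (fun s => MARC.bep C lam lamR ((k₀ / n₀ : ℝ) * (s * N0)) N0 u j) 2) := by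
  refine ⟨⟨?_, ?_⟩, ?_⟩
  · refine ⟨1 / 2, lam ^ 2 / 2, 3 / 4 * lam ^ 2, by norm_num, by positivity, by positivity,
      MARC.remainder lam, MARC.remainder_isLittleO hlam,
      fun p s _ => MARC.bepBound_eq_asymptoticForm lam p s, ?_⟩
    obtain ⟨s₁, hs₁⟩ := eventually_atTop.1 (MARC.eventually_le_bothForwardedBound hlam)
    refine ⟨max s₁ 1, by positivity, fun n lamR N0 _ hN u j s hs => ?_⟩
    have h := MARC.uncoded_bep_le lamR hlam hN
      (one_pos.trans_le ((le_max_right _ _).trans hs)) u j (hs₁ s ((le_max_left _ _).trans hs))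
    exact ⟨h, h.trans_eq (MARC.bepBound_eq_asymptoticForm _ _ _)⟩
  · intro n lamR N0 hlamR hN u j
    have h1 := MARC.tendsto_stateProb (MARC.isViterbi_uncoded (Fin n))
      (MARC.uncoded_enc_injective _) lam hlamR hN one_pos u
    have h2 := MARC.hasDiversityOrder_bep (MARC.isViterbi_uncoded (Fin n))
      (MARC.uncoded_enc_injective _) hlam hlamR hN one_pos u j
    simp only [one_mul] at h1 h2
    exact ⟨h1, h2⟩
  · intro k₀ n₀ L G hG
    refine ⟨⟨2 ^ Fintype.card (Fin (L + MARC.memory G) × Fin n₀), _, _, by positivity, ?_, ?_,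
      fun _ => 0, isLittleO_zero _ _, fun C hC hV lamR N0 _ hN u j s hs =>
        MARC.coded_bep_le hG hC hV lamR hlam hN hs u j⟩, ?_⟩
    · positivity
    · positivity
    · intro C hC hV lamR N0 hlamR hN u j
      have hinj : Function.Injective C.enc := hC ▸ MARC.convEnc_injective hG
      have hr := MARC.rate_pos hG j.2
      exact ⟨MARC.tendsto_stateProb hV hinj lam hlamR hN hr u,
        MARC.hasDiversityOrder_bep hV hinj hlam hlamR hN hr u j⟩
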